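/- **Theorem (Leading Derivatives Theorem).** Let $A,B$ be normal complex $N\times N$ matrices and let $$I_N(z)=I_N(z;A,B)=\int_{U(N)} e^{-zN\operatorname{Tr}(AUBU^{-1})}\,\kappa_N(\mathrm dU),\qquad z\in\mathbb C,$$ where $\kappa_N$ is the normalized Haar measure on the unitary group $U(N)$; this is an entire function of $z$ with $I_N(0)=1$. Let $D\subseteq\mathbb C$ be any simply connected open set which contains $0$ and contains no zero of $I_N$, and let $F_N=F_N(\,\cdot\,;A,B)$ be the free energy on $D$, i.e. the holomorphic function on $D$ with $F_N(0)=0$ and $I_N(z)=e^{N^2F_N(z)}$ for $z\in D$ (so $F_N=N^{-2}\log I_N$). Then for every integer $1\le d\le N$ the $d$-th derivative of $F_N$ at $0$ is given by the absolutely convergent series $$F_N^{(d)}(0;A,B)=\sum_{g=0}^\infty\frac{C_{g,d}(A,B)}{N^{2g}},$$ where $$C_{g,d}(A,B)=\sum_{\alpha,\beta\vdash d}(-1)^{d+\ell(\alpha)+\ell(\beta)}\,\vec H_g(\alpha,\beta)\,\bigl(N^{-\ell(\alpha)}p_\alpha(A)\bigr)\bigl(N^{-\ell(\beta)}p_\beta(B)\bigr).$$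 Here the sum is over all pairs of partitions of $d$, $\ell(\alpha)$ is the number of parts of $\alpha$, $p_\alpha(A)=\prod_{i=1}^{\ell(\alpha)}\operatorname{Tr}(A^{\alpha_i})$, and the monotone double Hurwitz number $\vec H_g(\alpha,\beta)$ is the number of $(r+2)$-tuples $(\rho,\sigma,\tau_1,\dots,\tau_r)$ of permutations in the symmetric group $S(d)$ such that 1. $\rho$ has cycle type $\alpha$, $\sigma$ has cycle type $\beta$, and the $\tau_i$ are transpositions; 2. $\rho\sigma\tau_1\cdots\tau_r$ is the identity permutation; 3. the subgroup $\langle\rho,\sigma,\tau_1,\dots,\tau_r\rangle$ acts transitively on $\{1,\dots,d\}$; 4. $r=2g-2+\ell(\alpha)+\ell(\beta)$; 5. writing $\tau_i=(s_i\ t_i)$ with $s_i<t_i$, one has $t_1\le\dots\le t_r$. -/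

import Mathlib

open MeasureTheory Equiv
open scoped Topology

noncomputable section

namespace HCIZ

/-! ### Haar probability measure on the unitary group `U(N)` -/

instance instMeasurableSpaceUnitary (N : ℕ) :
    MeasurableSpace (Matrix.unitaryGroup (Fin N) ℂ) := borel _

instance instBorelSpaceUnitary (N : ℕ) :
    BorelSpace (Matrix.unitaryGroup (Fin N) ℂ) := ⟨rfl⟩

/-- The unitary group is compact. -/
instance instCompactSpaceUnitary (N : ℕ) :
    CompactSpace (Matrix.unitaryGroup (Fin N) ℂ) := by
  refine isCompact_iff_compactSpace.mp ?_
  have hK : IsCompact (Set.univ.pi fun _ : Fin N => Set.univ.pi fun _ : Fin N =>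
      Metric.closedBall (0 : ℂ) 1) :=
    isCompact_univ_pi fun _ => isCompact_univ_pi fun _ => isCompact_closedBall 0 1
  refine IsCompact.of_isClosed_subset (X := Matrix (Fin N) (Fin N) ℂ) hK isClosed_unitary ?_
  intro U hU i _ j _
  simpa using entry_norm_bound_of_unitary hU i j

/-- The Haar measure on `U(N)`, normalized to have total mass one. -/
def haarUnitary (N : ℕ) : Measure (Matrix.unitaryGroup (Fin N) ℂ) :=
  Measure.haarMeasure ⊤

instance instIsProbabilityMeasureHaarUnitary (N : ℕ) :
    IsProbabilityMeasure (haarUnitary N) :=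
  ⟨by
    have h := Measure.haarMeasure_self
      (K₀ := (⊤ : TopologicalSpace.PositiveCompacts (Matrix.unitaryGroup (Fin N) ℂ)))
    simpa [haarUnitary] using h⟩

/-! ### The partition function and the free energy -/

/-- The HCIZ integral `I_N(z; A, B) = ∫ exp(-z N Tr(A U B U⁻¹)) dU`. -/
def partitionFunction {N : ℕ} (A B : Matrix (Fin N) (Fin N) ℂ) (z : ℂ) : ℂ :=
  ∫ U : Matrix.unitaryGroup (Fin N) ℂ,
    Complex.exp (-z * N * Matrix.trace (A * (U : Matrix (Fin N) (Fin N) ℂ) * B *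
      ((U⁻¹ : Matrix.unitaryGroup (Fin N) ℂ) : Matrix (Fin N) (Fin N) ℂ))) ∂(haarUnitary N)

/-- A simply connected complex domain which contains the origin and avoids the zeros of the
HCIZ integral. -/
structure IsAdmissibleDomain {N : ℕ} (A B : Matrix (Fin N) (Fin N) ℂ) (D : Set ℂ) : Prop where
  isOpen : IsOpen D
  isSimplyConnected : IsSimplyConnected D
  zero_mem : (0 : ℂ) ∈ D
  ne_zero : ∀ z ∈ D, partitionFunction A B z ≠ 0

/-- `F` is the HCIZ free energy on `D`: the holomorphic function on `D` with `F 0 = 0` and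
`I_N(z; A, B) = exp (N² F z)`. -/
structure IsFreeEnergy {N : ℕ} (A B : Matrix (Fin N) (Fin N) ℂ) (D : Set ℂ) (F : ℂ → ℂ) :
    Prop where
  differentiableOn : DifferentiableOn ℂ F D
  map_zero : F 0 = 0
  exp_eq : ∀ z ∈ D, partitionFunction A B z = Complex.exp ((N : ℂ) ^ 2 * F z)

/-! ### Monotone double Hurwitz numbers -/

/-- `(ρ, σ, τ₁, …, τ_r)` is a transitive monotone factorization of the identity of `S(d)`, with
`ρ` of cycle type `α` and `σ` of cycle type `β`.
The parts of `ρ.partition` are all cycle lengths of `ρ`, fixed points included. -/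
structure IsMonotoneFactorization {d : ℕ} (α β : Nat.Partition d) (r : ℕ)
    (ρ σ : Perm (Fin d)) (τ : Fin r → Perm (Fin d)) : Prop where
  cycleType_left : ρ.partition.parts = α.parts
  cycleType_right : σ.partition.parts = β.parts
  isSwap : ∀ i, (τ i).IsSwap
  prod_eq_one : ρ * σ * (List.ofFn τ).prod = 1
  transitive : MulAction.IsPretransitive
    (Subgroup.closure ({ρ, σ} ∪ Set.range τ) : Subgroup (Perm (Fin d))) (Fin d)
  monotone : ∃ s t : Fin r → Fin d, (∀ i, s i < t i ∧ τ i = swap (s i) (t i)) ∧ Monotone t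

/-- The length `ℓ(α)`: the number of parts of the partition `α`. -/
def length {d : ℕ} (α : Nat.Partition d) : ℕ := α.parts.card

/-- The monotone double Hurwitz number: the number of transitive monotone factorizations with
`r = 2g - 2 + ℓ(α) + ℓ(β)` transpositions. (For `d ≥ 1` the lengths are at least one, so
the subtraction is not truncated.) -/
def monotoneHurwitz {d : ℕ} (g : ℕ) (α β : Nat.Partition d) : ℕ :=
  Set.ncard {x : Perm (Fin d) × Perm (Fin d) ×
      (Fin (2 * g + length α + length β - 2) → Perm (Fin d)) |
    IsMonotoneFactorization α β (2 * g + length α + length β - 2) x.1 x.2.1 x.2.2}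

/-! ### The coefficients of the expansion -/

/-- The power sum `p_α(A) = ∏ᵢ Tr(A ^ αᵢ)`. -/
def powerSum {N d : ℕ} (α : Nat.Partition d) (A : Matrix (Fin N) (Fin N) ℂ) : ℂ :=
  (α.parts.map fun k => Matrix.trace (A ^ k)).prod

/-- The coefficient `C_{g,d}(A, B)`. -/
def coeff {N : ℕ} (g d : ℕ) (A B : Matrix (Fin N) (Fin N) ℂ) : ℂ :=
  ∑ α : Nat.Partition d, ∑ β : Nat.Partition d,
    (-1 : ℂ) ^ (d + length α + length β) * (monotoneHurwitz g α β : ℂ) *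
      (((N : ℂ) ^ length α)⁻¹ * powerSum α A) * (((N : ℂ) ^ length β)⁻¹ * powerSum β B)

/-! ### The free energy is well defined -/

/-- The HCIZ integral is an entire function. -/
theorem differentiable_partitionFunction {N : ℕ} (A B : Matrix (Fin N) (Fin N) ℂ) :
    Differentiable ℂ (partitionFunction A B) := by
  set f : Matrix.unitaryGroup (Fin N) ℂ → ℂ := fun U =>
    Matrix.trace (A * (U : Matrix (Fin N) (Fin N) ℂ) * B *
      ((U⁻¹ : Matrix.unitaryGroup (Fin N) ℂ) : Matrix (Fin N) (Fin N) ℂ)) with hf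
  have hfc : Continuous f := by
    have h1 : Continuous fun U : Matrix.unitaryGroup (Fin N) ℂ =>
        (U : Matrix (Fin N) (Fin N) ℂ) := continuous_subtype_val
    have h2 : Continuous fun U : Matrix.unitaryGroup (Fin N) ℂ =>
        ((U⁻¹ : Matrix.unitaryGroup (Fin N) ℂ) : Matrix (Fin N) (Fin N) ℂ) :=
      continuous_subtype_val.comp continuous_inv
    exact (((continuous_const.mul h1).mul continuous_const).mul h2).matrix_trace
  obtain ⟨M, hM⟩ : ∃ M, ∀ U, ‖f U‖ ≤ M := by
    obtain ⟨M, hM⟩ := (isCompact_range hfc).isBounded.exists_norm_le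
    exact ⟨M, fun U => hM _ ⟨U, rfl⟩⟩
  intro z₀
  have hint : ∀ z : ℂ, Continuous fun U => Complex.exp (-z * N * f U) := fun z => by fun_prop
  have hbound : ∀ z ∈ Metric.ball z₀ 1, ∀ U,
      ‖Complex.exp (-z * N * f U) * (-1 * N * f U)‖ ≤
        Real.exp ((‖z₀‖ + 1) * N * M) * (1 * N * M) := by
    intro z hz U
    have hz' : ‖z‖ ≤ ‖z₀‖ + 1 := by
      have h1 := norm_sub_norm_le z z₀
      have h2 : ‖z - z₀‖ < 1 := by simpa [dist_eq_norm] using hz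
      linarith
    rw [norm_mul]
    have hM0 : 0 ≤ M := (norm_nonneg _).trans (hM U)
    refine mul_le_mul ?_ ?_ (norm_nonneg _) (Real.exp_nonneg _)
    · refine (Complex.norm_exp_le_exp_norm _).trans (Real.exp_le_exp.2 ?_)
      rw [norm_mul, norm_mul, norm_neg, Complex.norm_natCast]
      have := hM U
      gcongr
    · rw [norm_mul, norm_mul, norm_neg, norm_one, Complex.norm_natCast]
      have := hM U
      gcongr
  have key := hasDerivAt_integral_of_dominated_loc_of_deriv_le
    (μ := haarUnitary N) (F := fun z U => Complex.exp (-z * N * f U))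
    (F' := fun z U => Complex.exp (-z * N * f U) * (-1 * N * f U))
    (bound := fun _ => Real.exp ((‖z₀‖ + 1) * N * M) * (1 * N * M))
    (Metric.ball_mem_nhds z₀ one_pos)
    (Filter.Eventually.of_forall fun z => (hint z).aestronglyMeasurable)
    ((hint z₀).integrable_of_hasCompactSupport (HasCompactSupport.of_compactSpace _))
    (by
      have : Continuous fun U => Complex.exp (-z₀ * N * f U) * (-1 * N * f U) := by fun_prop
      exact this.aestronglyMeasurable)
    (Filter.Eventually.of_forall fun U z hz => hbound z hz U)
    (integrable_const _)
    (Filter.Eventually.of_forall fun U z _ => by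
      have h : HasDerivAt (fun z : ℂ => -z * N * f U) (-1 * N * f U) z :=
        (((hasDerivAt_id z).neg).mul_const _).mul_const _
      exact h.cexp)
  exact key.2.differentiableAt

theorem partitionFunction_zero {N : ℕ} (A B : Matrix (Fin N) (Fin N) ℂ) :
    partitionFunction A B 0 = 1 := by
  simp [partitionFunction]

/-- Admissible domains exist. -/
theorem exists_isAdmissibleDomain {N : ℕ} (A B : Matrix (Fin N) (Fin N) ℂ) :
    ∃ D, IsAdmissibleDomain A B D := by
  have h : ∀ᶠ z in 𝓝 (0 : ℂ), partitionFunction A B z ≠ 0 :=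
    (differentiable_partitionFunction A B).continuous.continuousAt.eventually_ne
      (by simp [partitionFunction_zero])
  obtain ⟨ε, hε, hball⟩ := Metric.eventually_nhds_iff_ball.1 h
  refine ⟨Metric.ball 0 ε, Metric.isOpen_ball, ?_, Metric.mem_ball_self hε, hball⟩
  have hne : (Metric.ball (0 : ℂ) ε).Nonempty := ⟨0, Metric.mem_ball_self hε⟩
  have := Convex.contractibleSpace (convex_ball (0 : ℂ) ε) hne
  exact SimplyConnectedSpace.ofContractible _

/-- The free energy exists on every admissible domain (when `N ≥ 1`). -/
theorem exists_isFreeEnergy {N : ℕ} (hN : N ≠ 0) (A B : Matrix (Fin N) (Fin N) ℂ) {D : Set ℂ}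
    (hD : IsAdmissibleDomain A B D) : ∃ F, IsFreeEnergy A B D F := by
  have hI := differentiable_partitionFunction A B
  obtain ⟨L, hLc, hL⟩ := Complex.exists_continuousOn_eqOn_exp_comp hD.isSimplyConnected
    hD.isOpen hI.continuous.continuousOn
    (by rintro ⟨z, hz, h0⟩; exact hD.ne_zero z hz h0)
  have hN' : (N : ℂ) ^ 2 ≠ 0 := pow_ne_zero _ (Nat.cast_ne_zero.2 hN)
  have hL0 : Complex.exp (L 0) = 1 := by
    have := hL hD.zero_mem
    simpa [partitionFunction_zero] using this
  have hLd : ∀ z ∈ D, DifferentiableAt ℂ L z := by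
    intro z hz
    have hca : ContinuousAt L z := hLc.continuousAt (hD.isOpen.mem_nhds hz)
    have he : Complex.exp ∘ L =ᶠ[𝓝 z] partitionFunction A B :=
      Filter.eventually_of_mem (hD.isOpen.mem_nhds hz) fun w hw => hL hw
    exact (HasDerivAt.of_comp_left hca (Complex.hasDerivAt_exp _) (hI z).hasDerivAt
      (Complex.exp_ne_zero _) he).differentiableAt
  refine ⟨fun z => (L z - L 0) / (N : ℂ) ^ 2, ?_, by simp, ?_⟩
  · intro z hz
    exact (((hLd z hz).sub_const _).div_const _).differentiableWithinAt
  · intro z hz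
    rw [mul_div_cancel₀ _ hN', Complex.exp_sub, hL0, div_one]
    exact (hL hz).symm

end HCIZ

end

/-! ### Conjugation by unitaries and invariance of Haar measure -/

noncomputable section

namespace HCIZ

/-! The derivatives of `partitionFunction A B` at `0` are, up to the factor `(-N) ^ k`, the moments
of `Tr (A U B U⁻¹)`. These are contractions of mixed moments of matrix entries of conjugates of `B`.
Left invariance of Haar measure gives Schwinger–Dyson equations for such moments, now with an
arbitrary matrix in each slot. Isolating the last of `d + 1` slots (`moment_succ`), they say that `N
+ J`, where `J` is the sum of the transpositions `(k last)` (a Jucys–Murphy element) acting on the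
row indices, sends the moment of order `d + 1` to a contraction of moments of order `d`.

The operator `J` has norm at most `d`, so for `d + 1 ≤ N` the operator `N + J` is inverted by a
Neumann series in `-1/N`. Iterating over the slots yields products of transpositions with weakly
monotone larger elements. The traces `permTraceSum` obey the same contraction rule without the `J`
term, so `hasSum_momentCoeff` expands the moments over monotone lists. Contracting with `A`
expresses the derivatives of the partition function as convergent sums over monotone factorizations,
weighted by power sums of the cycle types (`permTrace_eq_prod_parts`).

Taking the logarithm selects the connected factorizations. Monotone lists on complementary sets
merge in exactly one way and the weight is multiplicative, so all factorizations are obtained from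
connected ones by the exponential formula (`factorizationSum_fin_succ`). The equation `I' = N² F' I`
gives the derivatives of `F` the same recursion, and strong induction identifies the two
(`hasSum_connectedSum`).

It remains to group by cycle type and by genus. A connected factorization satisfies Riemann–Hurwitz:
an inequality, proved by linear algebra over `𝔽₂`, together with a parity from signs
(`exists_genus`), so only the lengths `r = 2g - 2 + ℓ(α) + ℓ(β)` occur. Each pair of cycle types is
summable separately: for `A = B = 1` every contribution to `connectedSum` is nonnegative, and that
case dominates each pair. -/

/-- The conjugate `U C U⁻¹`. -/
def conjBy {N : ℕ} (U : Matrix.unitaryGroup (Fin N) ℂ) (C : Matrix (Fin N) (Fin N) ℂ) :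
    Matrix (Fin N) (Fin N) ℂ :=
  (U : Matrix (Fin N) (Fin N) ℂ) * C *
    ((U⁻¹ : Matrix.unitaryGroup (Fin N) ℂ) : Matrix (Fin N) (Fin N) ℂ)

lemma coe_inv_mul_coe {N : ℕ} (U : Matrix.unitaryGroup (Fin N) ℂ) :
    ((U⁻¹ : Matrix.unitaryGroup (Fin N) ℂ) : Matrix (Fin N) (Fin N) ℂ) *
      (U : Matrix (Fin N) (Fin N) ℂ) = 1 := by
  simp

lemma conjBy_mul_left {N : ℕ} (U V : Matrix.unitaryGroup (Fin N) ℂ)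
    (C : Matrix (Fin N) (Fin N) ℂ) :
    conjBy (V * U) C = conjBy V (conjBy U C) := by
  simp [conjBy, Matrix.mul_assoc]

lemma conjBy_mul {N : ℕ} (U : Matrix.unitaryGroup (Fin N) ℂ) (C D : Matrix (Fin N) (Fin N) ℂ) :
    conjBy U C * conjBy U D = conjBy U (C * D) := by
  have h := coe_inv_mul_coe U
  simp only [conjBy, Matrix.mul_assoc]
  rw [← Matrix.mul_assoc _ (U : Matrix (Fin N) (Fin N) ℂ), h, Matrix.one_mul]

lemma trace_conjBy {N : ℕ} (U : Matrix.unitaryGroup (Fin N) ℂ) (C : Matrix (Fin N) (Fin N) ℂ) :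
    (conjBy U C).trace = C.trace := by
  rw [conjBy, Matrix.trace_mul_comm, ← Matrix.mul_assoc, coe_inv_mul_coe, Matrix.one_mul]

@[fun_prop]
lemma continuous_conjBy {N : ℕ} (C : Matrix (Fin N) (Fin N) ℂ) :
    Continuous fun U : Matrix.unitaryGroup (Fin N) ℂ => conjBy U C := by
  have h1 : Continuous fun U : Matrix.unitaryGroup (Fin N) ℂ =>
      (U : Matrix (Fin N) (Fin N) ℂ) := continuous_subtype_val
  have h2 : Continuous fun U : Matrix.unitaryGroup (Fin N) ℂ =>
      ((U⁻¹ : Matrix.unitaryGroup (Fin N) ℂ) : Matrix (Fin N) (Fin N) ℂ) :=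
    continuous_subtype_val.comp continuous_inv
  exact (h1.mul continuous_const).mul h2

lemma integrable_of_continuous {N : ℕ} {f : Matrix.unitaryGroup (Fin N) ℂ → ℂ}
    (hf : Continuous f) : Integrable f (haarUnitary N) :=
  hf.integrable_of_hasCompactSupport (HasCompactSupport.of_compactSpace _)

instance {N : ℕ} : (haarUnitary N).IsMulLeftInvariant := by
  unfold haarUnitary; infer_instance

/-! ### One-parameter subgroups of the unitary group -/

section OneParameter
open scoped Matrix.Norms.Operator

lemma star_exp_smul_of_mem_skewAdjoint {N : ℕ} {Y : Matrix (Fin N) (Fin N) ℂ}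
    (hY : Y ∈ skewAdjoint (Matrix (Fin N) (Fin N) ℂ)) (t : ℝ) :
    star (NormedSpace.exp (t • Y)) = NormedSpace.exp (t • (-Y)) := by
  rw [skewAdjoint.mem_iff] at hY
  rw [Matrix.star_eq_conjTranspose, ← Matrix.exp_conjTranspose, ← Matrix.star_eq_conjTranspose,
    star_smul, hY, star_trivial]

/-- The one-parameter group generated by a skew-Hermitian matrix. -/
def expUnitary {N : ℕ} (Y : Matrix (Fin N) (Fin N) ℂ)
    (hY : Y ∈ skewAdjoint (Matrix (Fin N) (Fin N) ℂ)) (t : ℝ) :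
    Matrix.unitaryGroup (Fin N) ℂ :=
  ⟨NormedSpace.exp (t • Y), by
    rw [Matrix.mem_unitaryGroup_iff, star_exp_smul_of_mem_skewAdjoint hY,
      ← Matrix.exp_add_of_commute]
    · simp
    · rw [smul_neg]; exact (Commute.refl _).neg_right⟩

lemma hasDerivAt_conjBy_expUnitary {N : ℕ} (Y : Matrix (Fin N) (Fin N) ℂ)
    (hY : Y ∈ skewAdjoint (Matrix (Fin N) (Fin N) ℂ)) (C : Matrix (Fin N) (Fin N) ℂ) (t : ℝ) :
    HasDerivAt (fun t => conjBy (expUnitary Y hY t) C)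
      (Y * conjBy (expUnitary Y hY t) C - conjBy (expUnitary Y hY t) C * Y) t := by
  have hinv : ∀ t : ℝ, (((expUnitary Y hY t)⁻¹ : Matrix.unitaryGroup (Fin N) ℂ) :
      Matrix (Fin N) (Fin N) ℂ) = NormedSpace.exp (t • (-Y)) := fun t =>
    star_exp_smul_of_mem_skewAdjoint hY t
  have h1 : HasDerivAt (fun t : ℝ => NormedSpace.exp (t • Y)) (Y * NormedSpace.exp (t • Y)) t :=
    hasDerivAt_exp_smul_const' Y t
  have h2 : HasDerivAt (fun t : ℝ => NormedSpace.exp (t • (-Y)))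
      (NormedSpace.exp (t • (-Y)) * (-Y)) t := hasDerivAt_exp_smul_const (-Y) t
  have h3 := (h1.mul_const C).mul h2
  simp only [conjBy, hinv]
  refine h3.congr_deriv ?_
  simp [expUnitary, Matrix.mul_assoc, sub_eq_add_neg]

lemma hasDerivAt_conjBy_expUnitary_apply {N : ℕ} (Y : Matrix (Fin N) (Fin N) ℂ)
    (hY : Y ∈ skewAdjoint (Matrix (Fin N) (Fin N) ℂ)) (C : Matrix (Fin N) (Fin N) ℂ) (t : ℝ)
    (i j : Fin N) :
    HasDerivAt (fun t => conjBy (expUnitary Y hY t) C i j)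
      ((Y * conjBy (expUnitary Y hY t) C - conjBy (expUnitary Y hY t) C * Y) i j) t := by
  have h := (hasDerivAt_pi (E' := fun _ : Fin N => Fin N → ℂ)).1
    (hasDerivAt_conjBy_expUnitary Y hY C t) i
  exact hasDerivAt_pi.1 h j

lemma expUnitary_zero {N : ℕ} (Y : Matrix (Fin N) (Fin N) ℂ)
    (hY : Y ∈ skewAdjoint (Matrix (Fin N) (Fin N) ℂ)) : expUnitary Y hY 0 = 1 := by
  ext1; simp [expUnitary]

end OneParameter

/-! ### Mixed moments of conjugates -/

section moments
variable {N : ℕ} {α : Type*} [Fintype α]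

/-- The mixed moment `∫ ∏ₖ (U Cₖ U⁻¹)_{iₖ jₖ} dU`. -/
def moment (C : α → Matrix (Fin N) (Fin N) ℂ) (i j : α → Fin N) : ℂ :=
  ∫ U, ∏ k, conjBy U (C k) (i k) (j k) ∂(haarUnitary N)

lemma continuous_conjBy_apply (C : Matrix (Fin N) (Fin N) ℂ) (i j : Fin N) :
    Continuous fun U => conjBy U C i j := (continuous_conjBy C).matrix_elem i j

variable [DecidableEq α]

/-- The derivative at `U` of the integrand of `moment` along the infinitesimal generator `Y`. -/
def momentVariation (C : α → Matrix (Fin N) (Fin N) ℂ) (i j : α → Fin N)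
    (Y : Matrix (Fin N) (Fin N) ℂ) (U : Matrix.unitaryGroup (Fin N) ℂ) : ℂ :=
  ∑ k, (∏ l ∈ Finset.univ.erase k, conjBy U (C l) (i l) (j l)) *
    (Y * conjBy U (C k) - conjBy U (C k) * Y) (i k) (j k)

lemma continuous_momentVariation (C : α → Matrix (Fin N) (Fin N) ℂ) (i j : α → Fin N)
    (Y : Matrix (Fin N) (Fin N) ℂ) : Continuous (momentVariation C i j Y) := by
  refine continuous_finsetSum _ fun k _ => ?_
  refine (continuous_finsetProd _ fun l _ => continuous_conjBy_apply _ _ _).mul ?_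
  have h := continuous_conjBy (C k)
  exact ((continuous_const.mul h).sub (h.mul continuous_const)).matrix_elem _ _

/-- Translating the integrand on the left by `expUnitary Y hY t` does not change its Haar integral.
Differentiating this constant function of `t` at `0` under the integral sign gives zero. -/
lemma integral_momentVariation_of_skewAdjoint (C : α → Matrix (Fin N) (Fin N) ℂ)
    (i j : α → Fin N) {Y : Matrix (Fin N) (Fin N) ℂ}
    (hY : Y ∈ skewAdjoint (Matrix (Fin N) (Fin N) ℂ)) :
    ∫ U, momentVariation C i j Y U ∂(haarUnitary N) = 0 := by
  obtain ⟨K, hK⟩ : ∃ K, ∀ U, ‖momentVariation C i j Y U‖ ≤ K := by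
    obtain ⟨M, hM⟩ :=
      (isCompact_range (continuous_momentVariation C i j Y)).isBounded.exists_norm_le
    exact ⟨M, fun U => hM _ ⟨U, rfl⟩⟩
  have hc : Continuous fun U => ∏ k, conjBy U (C k) (i k) (j k) :=
    continuous_finsetProd _ fun l _ => continuous_conjBy_apply _ _ _
  have key := hasDerivAt_integral_of_dominated_loc_of_deriv_le
    (μ := haarUnitary N) (s := Set.univ) (x₀ := (0 : ℝ))
    (F := fun t U => ∏ k, conjBy (expUnitary Y hY t * U) (C k) (i k) (j k))
    (F' := fun t U => momentVariation C i j Y (expUnitary Y hY t * U))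
    (bound := fun _ => K) Filter.univ_mem
    (Filter.Eventually.of_forall fun t =>
      (hc.comp (continuous_const.mul continuous_id)).aestronglyMeasurable)
    (integrable_of_continuous (hc.comp (continuous_const.mul continuous_id)))
    (((continuous_momentVariation C i j Y).comp
      (continuous_const.mul continuous_id)).aestronglyMeasurable)
    (Filter.Eventually.of_forall fun U t _ => hK _)
    (integrable_const _)
    (Filter.Eventually.of_forall fun U t _ => by
      simp only [conjBy_mul_left, momentVariation]
      have := HasDerivAt.fun_finsetProd (u := Finset.univ) (x := t)
        (f := fun k t => conjBy (expUnitary Y hY t) (conjBy U (C k)) (i k) (j k))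
        (fun k _ => hasDerivAt_conjBy_expUnitary_apply Y hY (conjBy U (C k)) t (i k) (j k))
      simpa using this)
  have h := key.2
  simp only [integral_mul_left_eq_self (μ := haarUnitary N)
    (fun U => ∏ k, conjBy U (C k) (i k) (j k)), expUnitary_zero, one_mul] at h
  exact h.unique (hasDerivAt_const _ _)

lemma momentVariation_add (C : α → Matrix (Fin N) (Fin N) ℂ) (i j : α → Fin N)
    (Y Z : Matrix (Fin N) (Fin N) ℂ) (U : Matrix.unitaryGroup (Fin N) ℂ) :
    momentVariation C i j (Y + Z) U = momentVariation C i j Y U + momentVariation C i j Z U := by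
  simp only [momentVariation, ← Finset.sum_add_distrib, ← mul_add]
  refine Finset.sum_congr rfl fun k _ => ?_
  congr 1
  simp only [add_mul, mul_add, Matrix.sub_apply, Matrix.add_apply]
  ring

lemma momentVariation_smul (C : α → Matrix (Fin N) (Fin N) ℂ) (i j : α → Fin N)
    (c : ℂ) (Y : Matrix (Fin N) (Fin N) ℂ) (U : Matrix.unitaryGroup (Fin N) ℂ) :
    momentVariation C i j (c • Y) U = c * momentVariation C i j Y U := by
  simp only [momentVariation, Finset.mul_sum]
  refine Finset.sum_congr rfl fun k _ => ?_
  simp only [smul_mul_assoc, mul_smul_comm, Matrix.sub_apply, Matrix.smul_apply, smul_eq_mul]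
  ring

/-- The variation is complex linear in `Y`, and the skew-Hermitian matrices span all matrices over
`ℂ`. -/
lemma integral_momentVariation (C : α → Matrix (Fin N) (Fin N) ℂ)
    (i j : α → Fin N) (Y : Matrix (Fin N) (Fin N) ℂ) :
    ∫ U, momentVariation C i j Y U ∂(haarUnitary N) = 0 := by
  have h1 : (1 / 2 : ℂ) • (Y - star Y) ∈ skewAdjoint (Matrix (Fin N) (Fin N) ℂ) := by
    rw [skewAdjoint.mem_iff, star_smul, star_sub, star_star, ← smul_neg]; simp
  have h2 : (-Complex.I / 2) • (Y + star Y) ∈ skewAdjoint (Matrix (Fin N) (Fin N) ℂ) := by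
    rw [skewAdjoint.mem_iff, star_smul, star_add, star_star, ← neg_smul, add_comm]
    simp [neg_div]
  have hY : Y = (1 / 2 : ℂ) • (Y - star Y) + Complex.I • (-Complex.I / 2) • (Y + star Y) := by
    rw [smul_smul, mul_div_assoc', mul_neg, Complex.I_mul_I]
    simp only [smul_sub, smul_add]
    have : Y = (1 / 2 : ℂ) • Y + (1 / 2 : ℂ) • Y := by rw [← add_smul]; norm_num
    nth_rewrite 1 [this]
    norm_num
  rw [hY]
  simp only [momentVariation_add, momentVariation_smul C i j Complex.I]
  rw [integral_add, integral_const_mul, integral_momentVariation_of_skewAdjoint C i j h1,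
    integral_momentVariation_of_skewAdjoint C i j h2]
  · simp
  · exact integrable_of_continuous (continuous_momentVariation _ _ _ _)
  · exact (integrable_of_continuous (continuous_momentVariation _ _ _ _)).const_mul _

/-- The Schwinger–Dyson equations for the moments of conjugates. -/
lemma sum_moment_update (C : α → Matrix (Fin N) (Fin N) ℂ) (i j : α → Fin N) (p q : Fin N) :
    ∑ k, (if i k = p then moment C (Function.update i k q) j else 0) =
      ∑ k, (if j k = q then moment C i (Function.update j k p) else 0) := by
  -- For the elementary matrix `E_pq`, left multiplication turns a row index `p` into `q`, and right
  -- multiplication turns a column index `q` into `p`.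
  have h := integral_momentVariation C i j (Matrix.single p q 1)
  have e1 : ∀ k U, (∏ l ∈ Finset.univ.erase k, conjBy U (C l) (i l) (j l)) *
        conjBy U (C k) q (j k) =
      ∏ l, conjBy U (C l) (Function.update i k q l) (j l) := by
    intro k U
    rw [← Finset.prod_erase_mul _ _ (Finset.mem_univ k)]
    congr 1
    · refine Finset.prod_congr rfl fun l hl => ?_
      rw [Function.update_of_ne (Finset.ne_of_mem_erase hl)]
    · simp
  have e2 : ∀ k U, (∏ l ∈ Finset.univ.erase k, conjBy U (C l) (i l) (j l)) *
        conjBy U (C k) (i k) p =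
      ∏ l, conjBy U (C l) (i l) (Function.update j k p l) := by
    intro k U
    rw [← Finset.prod_erase_mul _ _ (Finset.mem_univ k)]
    congr 1
    · refine Finset.prod_congr rfl fun l hl => ?_
      rw [Function.update_of_ne (Finset.ne_of_mem_erase hl)]
    · simp
  have hc : ∀ a b : α → Fin N, Integrable (fun U => ∏ l, conjBy U (C l) (a l) (b l))
      (haarUnitary N) := fun a b =>
    integrable_of_continuous (continuous_finsetProd _ fun l _ => continuous_conjBy_apply _ _ _)
  have e3 : ∀ U, momentVariation C i j (Matrix.single p q 1) U =
      ∑ k, ((if i k = p then (1 : ℂ) else 0) *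
          (∏ l, conjBy U (C l) (Function.update i k q l) (j l)) -
        (if j k = q then (1 : ℂ) else 0) *
          ∏ l, conjBy U (C l) (i l) (Function.update j k p l)) := by
    intro U
    refine Finset.sum_congr rfl fun k _ => ?_
    rw [← e1, ← e2, Matrix.sub_apply, mul_sub]
    congr 1
    · by_cases hk : i k = p
      · rw [hk]; simp
      · rw [Matrix.single_mul_apply_of_ne _ _ _ _ _ hk]; simp [hk]
    · by_cases hk : j k = q
      · rw [hk]; simp
      · rw [Matrix.mul_single_apply_of_ne _ _ _ _ _ hk]; simp [hk]
  simp only [e3] at h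
  rw [integral_finsetSum] at h
  · have e4 : ∀ k, ∫ U, ((if i k = p then (1 : ℂ) else 0) *
          (∏ l, conjBy U (C l) (Function.update i k q l) (j l)) -
        (if j k = q then (1 : ℂ) else 0) *
          ∏ l, conjBy U (C l) (i l) (Function.update j k p l)) ∂(haarUnitary N) =
        (if i k = p then moment C (Function.update i k q) j else 0) -
        (if j k = q then moment C i (Function.update j k p) else 0) := by
      intro k
      rw [integral_sub ((hc _ _).const_mul _) ((hc _ _).const_mul _), integral_const_mul,
        integral_const_mul]
      simp [moment]
    simp only [e4, Finset.sum_sub_distrib] at h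
    exact sub_eq_zero.1 h
  · exact fun k _ => ((hc _ _).const_mul _).sub ((hc _ _).const_mul _)

end moments

/-! ### Contraction of the last factor -/

/-- Sum over the ways of contracting the last factor of a tensor with `d + 1` factors, either with
itself or with one of the other factors. -/
def contractLast {N d : ℕ}
    (Φ : (Fin d → Matrix (Fin N) (Fin N) ℂ) → (Fin d → Fin N) → (Fin d → Fin N) → ℂ)
    (C : Fin (d + 1) → Matrix (Fin N) (Fin N) ℂ) (i j : Fin (d + 1) → Fin N) : ℂ :=
  (if i (Fin.last d) = j (Fin.last d) then (C (Fin.last d)).trace *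
    Φ (C ∘ Fin.castSucc) (i ∘ Fin.castSucc) (j ∘ Fin.castSucc) else 0) +
  ∑ k : Fin d, if j k.castSucc = i (Fin.last d) then
    Φ (Function.update (C ∘ Fin.castSucc) k (C k.castSucc * C (Fin.last d)))
      (i ∘ Fin.castSucc) (Function.update (j ∘ Fin.castSucc) k (j (Fin.last d))) else 0

/-- Summing the diagonal entries of the last conjugate produces its trace, which does not depend on
`U`. -/
lemma sum_moment_update_last_same {N d : ℕ} (C : Fin (d + 1) → Matrix (Fin N) (Fin N) ℂ)
    (i j : Fin (d + 1) → Fin N) :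
    ∑ a, moment C (Function.update i (Fin.last d) a) (Function.update j (Fin.last d) a) =
      (C (Fin.last d)).trace *
        moment (C ∘ Fin.castSucc) (i ∘ Fin.castSucc) (j ∘ Fin.castSucc) := by
  simp only [moment]
  rw [← integral_finsetSum]
  · rw [← integral_const_mul]
    refine integral_congr_ae (Filter.Eventually.of_forall fun U => ?_)
    simp only [Fin.prod_univ_castSucc, Function.update_self,
      Function.update_of_ne (Fin.castSucc_lt_last _).ne, Function.comp_apply]
    rw [← Finset.mul_sum, mul_comm, ← trace_conjBy U]
    rfl
  · exact fun k _ => integrable_of_continuous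
      (continuous_finsetProd _ fun l _ => continuous_conjBy_apply _ _ _)

/-- A shared index between slot `k` and the last slot forms a matrix product of two conjugates,
which is the conjugate of the product. -/
lemma sum_moment_update_last_castSucc {N d : ℕ} (C : Fin (d + 1) → Matrix (Fin N) (Fin N) ℂ)
    (i j : Fin (d + 1) → Fin N) (k : Fin d) :
    ∑ a, moment C (Function.update i (Fin.last d) a) (Function.update j k.castSucc a) =
      moment (Function.update (C ∘ Fin.castSucc) k (C k.castSucc * C (Fin.last d)))
        (i ∘ Fin.castSucc) (Function.update (j ∘ Fin.castSucc) k (j (Fin.last d))) := by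
  simp only [moment]
  rw [← integral_finsetSum]
  · refine integral_congr_ae (Filter.Eventually.of_forall fun U => ?_)
    simp only [Fin.prod_univ_castSucc, Function.update_self,
      Function.update_of_ne (Fin.castSucc_lt_last _).ne, Function.comp_apply,
      Function.update_of_ne (Fin.castSucc_lt_last _).ne']
    have e1 : ∀ a, ∏ x : Fin d, conjBy U (C x.castSucc) (i x.castSucc)
        (Function.update j k.castSucc a x.castSucc) =
        (∏ x ∈ Finset.univ.erase k, conjBy U (C x.castSucc) (i x.castSucc) (j x.castSucc)) *
          conjBy U (C k.castSucc) (i k.castSucc) a := by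
      intro a
      rw [← Finset.prod_erase_mul _ _ (Finset.mem_univ k)]
      congr 1
      · refine Finset.prod_congr rfl fun l hl => ?_
        rw [Function.update_of_ne]
        exact fun h => Finset.ne_of_mem_erase hl (Fin.castSucc_injective _ h)
      · simp
    simp only [e1]
    rw [← Finset.prod_erase_mul _ _ (Finset.mem_univ k)]
    simp only [Function.update_self, mul_assoc]
    rw [← Finset.mul_sum, ← conjBy_mul, Matrix.mul_apply]
    congr 1
    refine Finset.prod_congr rfl fun l hl => ?_
    rw [Function.update_of_ne (Finset.ne_of_mem_erase hl),
      Function.update_of_ne (Finset.ne_of_mem_erase hl), Function.comp_apply, Function.comp_apply]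
  · exact fun k _ => integrable_of_continuous
      (continuous_finsetProd _ fun l _ => continuous_conjBy_apply _ _ _)

/-- The Schwinger–Dyson equation obtained by contracting the last factor. -/
lemma moment_succ {N d : ℕ} (C : Fin (d + 1) → Matrix (Fin N) (Fin N) ℂ)
    (i j : Fin (d + 1) → Fin N) :
    (N : ℂ) * moment C i j + ∑ k : Fin d, moment C (i ∘ swap k.castSucc (Fin.last d)) j =
      contractLast moment C i j := by
  -- The last row index is set to the free value `a`, and `sum_moment_update` is used with `p = a`
  -- and `q` the original last row index. On the left the last slot contributes for every `a`,
  -- giving the factor `N`; slot `k` contributes only for `a = i k`, which exchanges two row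
  -- indices. On the right `a` becomes a repeated index to be contracted.
  have h := Finset.sum_congr (rfl : (Finset.univ : Finset (Fin N)) = _) fun a _ =>
    sum_moment_update C (Function.update i (Fin.last d) a) j a (i (Fin.last d))
  rw [Finset.sum_comm, Finset.sum_comm (s := Finset.univ (α := Fin N)), Fin.sum_univ_castSucc,
    Fin.sum_univ_castSucc] at h
  simp only [Function.update_self, if_true, Function.update_idem, Function.update_eq_self,
    Finset.sum_const, Finset.card_univ, Fintype.card_fin, nsmul_eq_mul,
    Function.update_of_ne (Fin.castSucc_lt_last _).ne] at h
  rw [add_comm] at h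
  have e1 : ∀ k : Fin d, ∑ a, (if i k.castSucc = a then moment C
      (Function.update (Function.update i (Fin.last d) a) k.castSucc (i (Fin.last d))) j else 0) =
      moment C (i ∘ swap k.castSucc (Fin.last d)) j := by
    intro k
    rw [Finset.sum_ite_eq]
    simp only [Finset.mem_univ, if_true]
    congr 1
    rw [Equiv.comp_swap_eq_update]
  have e2 : ∀ k : Fin (d + 1), ∑ a, (if j k = i (Fin.last d) then moment C
      (Function.update i (Fin.last d) a) (Function.update j k a) else 0) =
      if j k = i (Fin.last d) then ∑ a, moment C
      (Function.update i (Fin.last d) a) (Function.update j k a) else 0 := by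
    intro k
    split_ifs <;> simp
  simp only [e1, e2] at h
  rw [h, contractLast, add_comm, sum_moment_update_last_same]
  congr 1
  · simp only [eq_comm]
  · simp only [sum_moment_update_last_castSucc]

/-! ### Traces of permutation operators -/

/-- The trace of the product of a permutation operator and `⨂ₓ Cₓ`. -/
def permTrace {N : ℕ} {α : Type*} [Fintype α] [DecidableEq α] (σ : Perm α)
    (C : α → Matrix (Fin N) (Fin N) ℂ) : ℂ :=
  ∑ m : α → Fin N, ∏ x, C x (m x) (m (σ x))

/-- The sum of `permTrace σ C` over the permutations `σ` with `i ∘ σ = j`. -/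
def permTraceSum {N : ℕ} {α : Type*} [Fintype α] [DecidableEq α]
    (C : α → Matrix (Fin N) (Fin N) ℂ) (i j : α → Fin N) : ℂ :=
  ∑ σ : Perm α, if i ∘ σ = j then permTrace σ C else 0

/-- The extension of a permutation of `Fin d` to `Fin (d + 1)` fixing the last element. -/
def extendLast {d : ℕ} (σ : Perm (Fin d)) : Perm (Fin (d + 1)) :=
  (finSuccEquivLast.symm.permCongr (optionCongr σ))

@[simp] lemma extendLast_last {d : ℕ} (σ : Perm (Fin d)) :
    extendLast σ (Fin.last d) = Fin.last d := by
  simp [extendLast]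

@[simp] lemma extendLast_castSucc {d : ℕ} (σ : Perm (Fin d)) (x : Fin d) :
    extendLast σ x.castSucc = (σ x).castSucc := by
  simp [extendLast]

/-- A permutation of `Fin (d + 1)` is uniquely a product of a permutation fixing the last element
and a transposition (or the identity). -/
lemma sum_perm_succ {d : ℕ} (f : Perm (Fin (d + 1)) → ℂ) :
    ∑ σ, f σ = ∑ σ : Perm (Fin d), f (extendLast σ) +
      ∑ k : Fin d, ∑ σ : Perm (Fin d), f (extendLast σ * swap k.castSucc (Fin.last d)) := by
  -- The point `k` is recovered as the preimage of the last point; a count of cardinalities then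
  -- gives bijectivity.
  have hinj : Function.Injective fun x : Fin (d + 1) × Perm (Fin d) =>
      extendLast x.2 * swap x.1 (Fin.last d) := by
    rintro ⟨k, σ⟩ ⟨k', σ'⟩ h
    simp only at h
    have h1 : ∀ (k : Fin (d + 1)) (σ : Perm (Fin d)),
        (extendLast σ * swap k (Fin.last d)) k = Fin.last d := by simp
    have hk : k = k' := by
      refine (extendLast σ' * swap k' (Fin.last d)).injective ?_
      rw [h1 k' σ', ← h, h1]
    subst hk
    have hσ := mul_right_cancel h
    have : σ = σ' := by
      ext x
      have := congrArg (fun τ : Perm (Fin (d + 1)) => τ x.castSucc) hσ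
      simpa [Fin.ext_iff] using this
    rw [this]
  have hbij := (Fintype.bijective_iff_injective_and_card _).2 ⟨hinj, by
    simp [Fintype.card_perm, Nat.factorial_succ]⟩
  rw [← hbij.sum_comp f, Fintype.sum_prod_type, Fin.sum_univ_castSucc, add_comm]
  simp [Perm.one_def.symm]

/-- The last point is a cycle of length one, and its index occurs in no other factor. -/
lemma permTrace_extendLast {N d : ℕ} (σ : Perm (Fin d))
    (C : Fin (d + 1) → Matrix (Fin N) (Fin N) ℂ) :
    permTrace (extendLast σ) C = (C (Fin.last d)).trace * permTrace σ (C ∘ Fin.castSucc) := by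
  rw [permTrace, ← (Fin.snocEquiv fun _ => Fin N).sum_comp, Fintype.sum_prod_type]
  simp only [Fin.snocEquiv_apply, Fin.prod_univ_castSucc, extendLast_castSucc, extendLast_last,
    Fin.snoc_castSucc, Fin.snoc_last]
  simp only [← Finset.sum_mul]
  rw [← Finset.mul_sum, mul_comm]
  rfl

/-- Multiplying by `(k last)` inserts the last point just after `k` in its cycle, so summing over
the last index multiplies the matrix at `k` by the last one. -/
lemma permTrace_extendLast_mul_swap {N d : ℕ} (σ : Perm (Fin d)) (k : Fin d)
    (C : Fin (d + 1) → Matrix (Fin N) (Fin N) ℂ) :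
    permTrace (extendLast σ * swap k.castSucc (Fin.last d)) C =
      permTrace σ (Function.update (C ∘ Fin.castSucc) k (C k.castSucc * C (Fin.last d))) := by
  rw [permTrace, ← (Fin.snocEquiv fun _ => Fin N).sum_comp, Fintype.sum_prod_type,
    Finset.sum_comm]
  refine Finset.sum_congr rfl fun m _ => ?_
  simp only [Fin.snocEquiv_apply, Fin.prod_univ_castSucc, Perm.mul_apply, swap_apply_right,
    extendLast_castSucc, Fin.snoc_castSucc, Fin.snoc_last]
  rw [← Finset.prod_erase_mul _ _ (Finset.mem_univ k)]
  have e1 : ∀ a, ∏ x : Fin d, C x.castSucc (m x) ((Fin.snoc m a : Fin (d + 1) → Fin N)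
        (extendLast σ (swap k.castSucc (Fin.last d) x.castSucc))) =
      (∏ x ∈ Finset.univ.erase k, C x.castSucc (m x) (m (σ x))) *
        C k.castSucc (m k) a := by
    intro a
    rw [← Finset.prod_erase_mul _ _ (Finset.mem_univ k)]
    congr 1
    · refine Finset.prod_congr rfl fun l hl => ?_
      rw [swap_apply_of_ne_of_ne, extendLast_castSucc, Fin.snoc_castSucc]
      · exact fun h => Finset.ne_of_mem_erase hl (Fin.castSucc_injective _ h)
      · exact (Fin.castSucc_lt_last _).ne
    · simp
  simp only [e1, mul_assoc]
  rw [← Finset.mul_sum]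
  simp only [Function.update_self, Matrix.mul_apply]
  congr 1
  refine Finset.prod_congr rfl fun l hl => ?_
  rw [Function.update_of_ne (Finset.ne_of_mem_erase hl), Function.comp_apply]

lemma comp_extendLast_eq_iff {β : Type*} {d : ℕ} (σ : Perm (Fin d)) (i j : Fin (d + 1) → β) :
    i ∘ extendLast σ = j ↔
      i (Fin.last d) = j (Fin.last d) ∧ (i ∘ Fin.castSucc) ∘ σ = j ∘ Fin.castSucc := by
  simp only [funext_iff, Fin.forall_fin_succ', Function.comp_apply, extendLast_last,
    extendLast_castSucc]
  exact and_comm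

lemma comp_extendLast_mul_swap_eq_iff {β : Type*} {d : ℕ} (σ : Perm (Fin d)) (k : Fin d)
    (i j : Fin (d + 1) → β) :
    i ∘ (extendLast σ * swap k.castSucc (Fin.last d)) = j ↔
      j k.castSucc = i (Fin.last d) ∧
        (i ∘ Fin.castSucc) ∘ σ = Function.update (j ∘ Fin.castSucc) k (j (Fin.last d)) := by
  rw [Perm.coe_mul, ← Function.comp_assoc]
  have : (i ∘ extendLast σ) ∘ swap k.castSucc (Fin.last d) = j ↔
      i ∘ extendLast σ = j ∘ swap k.castSucc (Fin.last d) := by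
    constructor
    · rintro rfl
      ext x
      simp
    · intro h
      rw [h]
      ext x
      simp
  rw [this, comp_extendLast_eq_iff]
  simp only [Function.comp_apply, swap_apply_right]
  rw [eq_comm]
  refine and_congr_right fun _ => ?_
  have : (j ∘ swap k.castSucc (Fin.last d)) ∘ Fin.castSucc =
      Function.update (j ∘ Fin.castSucc) k (j (Fin.last d)) := by
    ext x
    by_cases hx : x = k
    · subst hx; simp
    · have : x.castSucc ≠ k.castSucc := fun h => hx (Fin.castSucc_injective _ h)
      simp [hx, swap_apply_of_ne_of_ne this (Fin.castSucc_lt_last _).ne]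
  rw [this]

/-- The two kinds of terms in `contractLast` match the two cases of `sum_perm_succ`: the last point
is fixed, or it is inserted after some `k`. Compared with `moment_succ`, the transposition terms and
the factor `N` are absent. -/
lemma permTraceSum_succ {N d : ℕ} (C : Fin (d + 1) → Matrix (Fin N) (Fin N) ℂ)
    (i j : Fin (d + 1) → Fin N) :
    permTraceSum C i j = contractLast permTraceSum C i j := by
  rw [permTraceSum, sum_perm_succ, contractLast]
  simp only [comp_extendLast_eq_iff, comp_extendLast_mul_swap_eq_iff, ite_and,
    permTrace_extendLast, permTrace_extendLast_mul_swap, permTraceSum]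
  congr 1
  · split_ifs
    · rw [Finset.mul_sum]
      refine Finset.sum_congr rfl fun σ _ => ?_
      split_ifs <;> simp
    · simp
  · refine Finset.sum_congr rfl fun k _ => ?_
    split_ifs
    · rfl
    · simp

/-! ### Monotone lists of transpositions -/

/-- A list of pairs `(s, t)` with `s < t` and weakly decreasing second components, encoding
a monotone sequence of transpositions in reverse order. -/
def IsMonoList {α : Type*} [LinearOrder α] (L : List (α × α)) : Prop :=
  (∀ p ∈ L, p.1 < p.2) ∧ L.Pairwise fun p q => q.2 ≤ p.2

open Classical in
/-- The finite set of monotone lists of a given length. -/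
def monoLists (α : Type*) [Fintype α] [LinearOrder α] (r : ℕ) : Finset (List (α × α)) :=
  (Finset.univ.image (List.ofFn : (Fin r → α × α) → List (α × α))).filter IsMonoList

lemma mem_monoLists {α : Type*} [Fintype α] [LinearOrder α] {r : ℕ} {L : List (α × α)} :
    L ∈ monoLists α r ↔ L.length = r ∧ IsMonoList L := by
  simp only [monoLists, Finset.mem_filter, Finset.mem_image, Finset.mem_univ, true_and]
  refine and_congr_left fun _ => ⟨?_, ?_⟩
  · rintro ⟨f, rfl⟩; simp
  · rintro rfl; exact ⟨L.get, List.ofFn_get L⟩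

/-- The product of the transpositions encoded by a list of pairs. -/
def listProd {α : Type*} [DecidableEq α] (L : List (α × α)) : Perm α :=
  (L.map fun p => swap p.1 p.2).prod

@[simp] lemma listProd_nil {α : Type*} [DecidableEq α] : listProd ([] : List (α × α)) = 1 := rfl

@[simp] lemma listProd_cons {α : Type*} [DecidableEq α] (p : α × α) (L : List (α × α)) :
    listProd (p :: L) = swap p.1 p.2 * listProd L := by simp [listProd]

lemma monoLists_zero {α : Type*} [Fintype α] [LinearOrder α] : monoLists α 0 = {[]} := by
  ext L
  simp only [mem_monoLists, Finset.mem_singleton, List.length_eq_zero_iff]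
  exact ⟨fun h => h.1, by rintro rfl; simp [IsMonoList]⟩

lemma sum_monoLists_zero {α : Type*} [Fintype α] [LinearOrder α] (φ : List (α × α) → ℂ) :
    ∑ L ∈ monoLists α 0, φ L = φ [] := by
  rw [monoLists_zero, Finset.sum_singleton]

lemma isMonoList_cons {α : Type*} [LinearOrder α] {p : α × α} {L : List (α × α)} :
    IsMonoList (p :: L) ↔ p.1 < p.2 ∧ (∀ q ∈ L, q.2 ≤ p.2) ∧ IsMonoList L := by
  simp only [IsMonoList, List.forall_mem_cons, List.pairwise_cons]
  tauto

lemma isMonoList_map {α β : Type*} [LinearOrder α] [LinearOrder β] {f : α → β}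
    (hf : StrictMono f) {L : List (α × α)} :
    IsMonoList (L.map (Prod.map f f)) ↔ IsMonoList L := by
  simp only [IsMonoList, List.pairwise_map, List.forall_mem_map, Prod.map_fst, Prod.map_snd,
    hf.lt_iff_lt, hf.le_iff_le]

/-- The head of a monotone list has the largest second component. Either that component is below the
last point, and then so is every entry, or the head is `(k, last)` and puts no restriction on the
tail. -/
lemma sum_monoLists_succ {d r : ℕ} (φ : List (Fin (d + 1) × Fin (d + 1)) → ℂ) :
    ∑ L ∈ monoLists (Fin (d + 1)) (r + 1), φ L =
      ∑ L ∈ monoLists (Fin d) (r + 1), φ (L.map (Prod.map Fin.castSucc Fin.castSucc)) +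
      ∑ k : Fin d, ∑ L ∈ monoLists (Fin (d + 1)) r, φ ((k.castSucc, Fin.last d) :: L) := by
  classical
  set f : List (Fin d × Fin d) → List (Fin (d + 1) × Fin (d + 1)) :=
    List.map (Prod.map Fin.castSucc Fin.castSucc) with hf
  set g : Fin d × List (Fin (d + 1) × Fin (d + 1)) → List (Fin (d + 1) × Fin (d + 1)) :=
    fun x => (x.1.castSucc, Fin.last d) :: x.2 with hg
  have hfi : Function.Injective f := List.map_injective_iff.2
    ((Fin.castSucc_injective _).prodMap (Fin.castSucc_injective _))
  have hgi : Function.Injective g := by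
    rintro ⟨k, L⟩ ⟨k', L'⟩ h
    simpa [hg] using h
  have key : monoLists (Fin (d + 1)) (r + 1) = (monoLists (Fin d) (r + 1)).image f ∪
      ((Finset.univ : Finset (Fin d)) ×ˢ monoLists (Fin (d + 1)) r).image g := by
    ext L
    simp only [Finset.mem_union, Finset.mem_image, mem_monoLists, Finset.mem_product,
      Finset.mem_univ, true_and]
    constructor
    · rintro ⟨hl, hL⟩
      obtain _ | ⟨⟨s, t⟩, L'⟩ := L
      · simp at hl
      rw [isMonoList_cons] at hL
      obtain ⟨hst, hle, hL'⟩ := hL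
      induction t using Fin.lastCases with
      | last =>
        right
        simp only at hst
        exact ⟨(s.castPred hst.ne, L'), ⟨by simpa using hl, hL'⟩, by simp [hg]⟩
      | cast t =>
        left
        have hall : ∀ p ∈ (s, t.castSucc) :: L', p ∈ Set.range
            (Prod.map (Fin.castSucc : Fin d → _) (Fin.castSucc : Fin d → _)) := by
          have hlt : ∀ p : Fin (d + 1) × Fin (d + 1), p.1 < p.2 → p.2 ≤ t.castSucc →
              p ∈ Set.range (Prod.map (Fin.castSucc : Fin d → _) (Fin.castSucc : Fin d → _)) := by
            rintro ⟨a, b⟩ hab hb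
            have hb' : b ≠ Fin.last d := (hb.trans_lt (Fin.castSucc_lt_last t)).ne
            have ha' : a ≠ Fin.last d := (hab.trans (hb.trans_lt (Fin.castSucc_lt_last t))).ne
            exact ⟨(a.castPred ha', b.castPred hb'), by simp⟩
          intro p hp
          rcases List.mem_cons.1 hp with rfl | hp
          · exact hlt _ hst le_rfl
          · exact hlt _ (hL'.1 p hp) (hle p hp)
        obtain ⟨L₀, hL₀⟩ : (s, t.castSucc) :: L' ∈ Set.range f := by
          rw [hf, Set.range_list_map]; exact hall
        refine ⟨L₀, ⟨?_, (isMonoList_map Fin.strictMono_castSucc).1 ?_⟩, hL₀⟩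
        · have := congrArg List.length hL₀
          simp only [hf, List.length_map] at this
          exact this.trans hl
        · change IsMonoList (f L₀)
          rw [hL₀, isMonoList_cons]
          exact ⟨hst, hle, hL'⟩
    · rintro (⟨L, ⟨hl, hL⟩, rfl⟩ | ⟨⟨k, L⟩, ⟨hl, hL⟩, rfl⟩)
      · exact ⟨by simp [hf, hl], (isMonoList_map Fin.strictMono_castSucc).2 hL⟩
      · exact ⟨by simp [hg, hl], isMonoList_cons.2
          ⟨Fin.castSucc_lt_last k, fun q _ => Fin.le_last _, hL⟩⟩
  rw [key, Finset.sum_union, Finset.sum_image hfi.injOn, Finset.sum_image hgi.injOn,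
    Finset.sum_product]
  rw [Finset.disjoint_left]
  intro L h1 h2
  obtain ⟨L₁, -, rfl⟩ := Finset.mem_image.1 h1
  obtain ⟨⟨k, L₂⟩, -, h⟩ := Finset.mem_image.1 h2
  obtain _ | ⟨p, L₁⟩ := L₁
  · simp [hf, hg] at h
  · simp only [hf, hg, List.map_cons, List.cons.injEq, Prod.ext_iff] at h
    exact (Fin.castSucc_lt_last p.2).ne h.1.2.symm

/-! ### A Neumann series -/

/-- A nonnegative sequence with `a (r + 1) ≤ b (r + 1) + θ a r`, `θ < 1`, is summable if `b` is. -/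
lemma summable_of_le_add_mul {a b : ℕ → ℝ} {θ : ℝ} (ha : ∀ r, 0 ≤ a r) (hb : ∀ r, 0 ≤ b r)
    (hθ1 : θ < 1) (h0 : a 0 ≤ b 0) (h : ∀ r, a (r + 1) ≤ b (r + 1) + θ * a r)
    (hs : Summable b) (hθ0 : 0 ≤ θ) : Summable a := by
  -- Summing the recursion shows that a partial sum `S` of `a` satisfies `S ≤ ∑' b + θ S`.
  have hB : ∀ n, ∑ r ∈ Finset.range n, a r ≤ (∑' r, b r) / (1 - θ) := by
    intro n
    rw [le_div_iff₀ (by linarith)]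
    have h1 : ∑ r ∈ Finset.range n, a r ≤
        ∑ r ∈ Finset.range n, b r + θ * ∑ r ∈ Finset.range n, a r := by
      obtain _ | n := n
      · simp
      have h2 : ∑ r ∈ Finset.range (n + 1), a r ≤
          ∑ r ∈ Finset.range (n + 1), b r + θ * ∑ r ∈ Finset.range n, a r := by
        rw [Finset.sum_range_succ', Finset.sum_range_succ', Finset.mul_sum]
        have := Finset.sum_le_sum fun r (_ : r ∈ Finset.range n) => h r
        rw [Finset.sum_add_distrib] at this
        linarith
      have h3 : θ * ∑ r ∈ Finset.range n, a r ≤ θ * ∑ r ∈ Finset.range (n + 1), a r := by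
        rw [Finset.sum_range_succ]
        nlinarith [mul_nonneg hθ0 (ha n)]
      linarith
    have h2 := hs.sum_le_tsum (Finset.range n) fun r _ => hb r
    linarith
  exact summable_of_sum_range_le ha hB

/-- If `x` solves `xᵣ₊₁(i) = yᵣ₊₁(i) + ∑ₖ xᵣ(sₖ i)`, then its generating function solves the
corresponding fixed-point equation, and is the only solution. -/
lemma hasSum_of_recursion {ι κ : Type*} [Fintype ι] [Fintype κ] (s : κ → ι → ι)
    (x y : ℕ → ι → ℂ) (h0 : ∀ i, x 0 i = y 0 i)
    (h : ∀ r i, x (r + 1) i = y (r + 1) i + ∑ k, x r (s k i)) (q : ℂ)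
    (hq : ‖q‖ * Fintype.card κ < 1) (Z Y : ι → ℂ) (hY : ∀ i, HasSum (fun r => q ^ r * y r i) (Y i))
    (hZ : ∀ i, Z i = Y i + q * ∑ k, Z (s k i)) (i : ι) :
    HasSum (fun r => q ^ r * x r i) (Z i) := by
  -- Summability is in the sup norm over the finite set `ι`, where one step of the recursion costs
  -- at most the factor `‖q‖ * card κ`.
  have hsum : Summable fun r => ‖q ^ r • x r‖ := by
    refine summable_of_le_add_mul (b := fun r => ‖q ^ r • y r‖) (θ := ‖q‖ * Fintype.card κ)
      (fun _ => norm_nonneg _) (fun _ => norm_nonneg _) hq ?_ ?_ ?_ (by positivity)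
    · rw [show x 0 = y 0 from funext h0]
    · intro r
      refine (pi_norm_le_iff_of_nonneg (by positivity)).2 fun i => ?_
      have e : (q ^ (r + 1) • x (r + 1)) i =
          (q ^ (r + 1) • y (r + 1)) i + q * ∑ k, (q ^ r • x r) (s k i) := by
        simp only [Pi.smul_apply, smul_eq_mul, h, ← Finset.mul_sum]
        ring
      rw [e]
      refine (norm_add_le _ _).trans (add_le_add (norm_le_pi_norm _ i) ?_)
      rw [norm_mul, mul_assoc]
      refine mul_le_mul_of_nonneg_left ?_ (norm_nonneg _)
      refine (norm_sum_le _ _).trans ?_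
      refine (Finset.sum_le_card_nsmul _ _ _ fun k _ => norm_le_pi_norm (q ^ r • x r) (s k i)).trans
        ?_
      simp
    · have : Summable fun r => q ^ r • y r := Pi.summable.2 fun i => (hY i).summable
      exact this.norm
  have hX : ∀ i, Summable fun r => q ^ r * x r i := fun i =>
    Pi.summable.1 hsum.of_norm i
  set X : ι → ℂ := fun i => ∑' r, q ^ r * x r i with hXdef
  have hXeq : ∀ i, X i = Y i + q * ∑ k, X (s k i) := by
    intro i
    have h1 : HasSum (fun r => q ^ (r + 1) * y (r + 1) i) (Y i - y 0 i) := by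
      have := (hasSum_nat_add_iff' 1).2 (hY i)
      simpa using this
    have h2 : HasSum (fun r => q * ∑ k, q ^ r * x r (s k i)) (q * ∑ k, X (s k i)) :=
      (hasSum_sum fun k _ => (hX (s k i)).hasSum).mul_left q
    have h3 := h1.add h2
    have h4 : HasSum (fun r => q ^ (r + 1) * x (r + 1) i) (X i - x 0 i) := by
      have := (hasSum_nat_add_iff' 1).2 (hX i).hasSum
      simpa using this
    have h5 := h4.unique (h3.congr_fun ?_)
    · rw [h0] at h5
      linear_combination h5
    · intro r
      simp only [h, ← Finset.mul_sum]
      ring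
  -- The difference of two solutions is a fixed point of a linear map of norm below one.
  have hXZ : X = Z := by
    by_contra hne
    have hpos : 0 < ‖X - Z‖ := norm_pos_iff.2 (sub_ne_zero.2 hne)
    have hle : ‖X - Z‖ ≤ ‖q‖ * Fintype.card κ * ‖X - Z‖ := by
      refine (pi_norm_le_iff_of_nonneg (by positivity)).2 fun i => ?_
      have e : (X - Z) i = q * ∑ k, (X - Z) (s k i) := by
        simp only [Pi.sub_apply, Finset.sum_sub_distrib]
        rw [hXeq i, hZ i]; ring
      rw [e, norm_mul, mul_assoc]
      refine mul_le_mul_of_nonneg_left ?_ (norm_nonneg _)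
      refine (norm_sum_le _ _).trans ?_
      refine (Finset.sum_le_card_nsmul _ _ _ fun k _ => norm_le_pi_norm (X - Z) (s k i)).trans ?_
      simp
    nlinarith
  rw [← hXZ]
  exact (hX i).hasSum

/-! ### The expansion of the moments -/

/-- The coefficient of `(-1/N)^r` in the expansion of `N^d` times the mixed moment. -/
def momentCoeff {N d : ℕ} (r : ℕ) (C : Fin d → Matrix (Fin N) (Fin N) ℂ) (i j : Fin d → Fin N) :
    ℂ :=
  ∑ L ∈ monoLists (Fin d) r, permTraceSum C (i ∘ listProd L) j

lemma listProd_map_castSucc {d : ℕ} (L : List (Fin d × Fin d)) :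
    listProd (L.map (Prod.map Fin.castSucc Fin.castSucc)) = extendLast (listProd L) := by
  induction L with
  | nil => ext x; induction x using Fin.lastCases <;> simp
  | cons p L ih =>
    rw [List.map_cons, listProd_cons, ih, listProd_cons]
    ext x
    induction x using Fin.lastCases with
    | last => simp [swap_apply_of_ne_of_ne, (Fin.castSucc_lt_last _).ne']
    | cast x =>
      simp only [Prod.map_fst, Prod.map_snd, Perm.mul_apply, extendLast_castSucc]
      rw [(Fin.castSucc_injective d).swap_apply]

/-- Lists on the first `d` points act by permutations fixing the last point, and so commute with its
contraction. -/
lemma contractLast_momentCoeff {N d r : ℕ} (C : Fin (d + 1) → Matrix (Fin N) (Fin N) ℂ)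
    (i j : Fin (d + 1) → Fin N) :
    contractLast (momentCoeff r) C i j =
      ∑ L ∈ monoLists (Fin d) r,
        permTraceSum C (i ∘ listProd (L.map (Prod.map Fin.castSucc Fin.castSucc))) j := by
  simp only [permTraceSum_succ, contractLast, Finset.sum_add_distrib, momentCoeff,
    listProd_map_castSucc, Function.comp_apply, extendLast_last]
  have hcomp : ∀ L : List (Fin d × Fin d), (i ∘ extendLast (listProd L)) ∘ Fin.castSucc =
      (i ∘ Fin.castSucc) ∘ listProd L := by
    intro L; ext x; simp
  simp only [hcomp]
  rw [Finset.sum_comm]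
  congr 1
  · split_ifs
    · rw [Finset.mul_sum]
    · simp
  · refine Finset.sum_congr rfl fun k _ => ?_
    split_ifs <;> simp

lemma momentCoeff_succ_zero {N d : ℕ} (C : Fin (d + 1) → Matrix (Fin N) (Fin N) ℂ)
    (i j : Fin (d + 1) → Fin N) :
    momentCoeff 0 C i j = contractLast (momentCoeff 0) C i j := by
  rw [contractLast_momentCoeff, momentCoeff, sum_monoLists_zero, sum_monoLists_zero]
  simp

/-- This is `sum_monoLists_succ`, with a head `(k, last)` moved onto the row indices. It is the
coefficient form of `moment_succ` after scaling. -/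
lemma momentCoeff_succ_succ {N d r : ℕ} (C : Fin (d + 1) → Matrix (Fin N) (Fin N) ℂ)
    (i j : Fin (d + 1) → Fin N) :
    momentCoeff (r + 1) C i j = contractLast (momentCoeff (r + 1)) C i j +
      ∑ k : Fin d, momentCoeff r C (i ∘ swap k.castSucc (Fin.last d)) j := by
  rw [contractLast_momentCoeff, momentCoeff, sum_monoLists_succ]
  congr 1

lemma hasSum_contractLast {N d : ℕ} {q : ℂ}
    {Φ : ℕ → (Fin d → Matrix (Fin N) (Fin N) ℂ) → (Fin d → Fin N) → (Fin d → Fin N) → ℂ}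
    {Ψ : (Fin d → Matrix (Fin N) (Fin N) ℂ) → (Fin d → Fin N) → (Fin d → Fin N) → ℂ}
    (h : ∀ C i j, HasSum (fun r => q ^ r * Φ r C i j) (Ψ C i j))
    (C : Fin (d + 1) → Matrix (Fin N) (Fin N) ℂ) (i j : Fin (d + 1) → Fin N) :
    HasSum (fun r => q ^ r * contractLast (Φ r) C i j) (contractLast Ψ C i j) := by
  simp only [contractLast, mul_add, Finset.mul_sum]
  refine HasSum.add ?_ (hasSum_sum fun k _ => ?_)
  · split_ifs
    · simp only [mul_left_comm (q ^ _)]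
      exact (h _ _ _).mul_left _
    · simp
  · split_ifs
    · exact h _ _ _
    · simp

lemma contractLast_smul {N d : ℕ} (c : ℂ)
    (Φ : (Fin d → Matrix (Fin N) (Fin N) ℂ) → (Fin d → Fin N) → (Fin d → Fin N) → ℂ)
    (C : Fin (d + 1) → Matrix (Fin N) (Fin N) ℂ) (i j : Fin (d + 1) → Fin N) :
    contractLast (fun C i j => c * Φ C i j) C i j = c * contractLast Φ C i j := by
  simp only [contractLast, mul_add, Finset.mul_sum, mul_ite, mul_zero, mul_left_comm]

/-- The expansion of the mixed moments in the stable range `d ≤ N`. -/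
theorem hasSum_momentCoeff {N : ℕ} (hN : N ≠ 0) {d : ℕ} (hd : d ≤ N)
    (C : Fin d → Matrix (Fin N) (Fin N) ℂ) (i j : Fin d → Fin N) :
    HasSum (fun r => (-(N : ℂ)⁻¹) ^ r * momentCoeff r C i j) ((N : ℂ) ^ d * moment C i j) := by
  have hN' : (N : ℂ) ≠ 0 := Nat.cast_ne_zero.2 hN
  induction d with
  | zero =>
    have h0 : ∀ r, r ≠ 0 → (-(N : ℂ)⁻¹) ^ r * momentCoeff r C i j = 0 := by
      intro r hr
      rw [momentCoeff, Finset.sum_eq_zero, mul_zero]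
      intro L hL
      obtain ⟨hl, -⟩ := mem_monoLists.1 hL
      obtain _ | ⟨p, L⟩ := L
      · exact absurd hl.symm hr
      · exact p.1.elim0
    convert hasSum_single 0 h0 using 1
    rw [momentCoeff, sum_monoLists_zero, permTraceSum, moment]
    simp [permTrace, Subsingleton.elim _ j]
  | succ d ih =>
    refine hasSum_of_recursion (fun (k : Fin d) (i : Fin (d + 1) → Fin N) =>
        i ∘ swap k.castSucc (Fin.last d)) (fun r i => momentCoeff r C i j)
      (fun r i => contractLast (momentCoeff r) C i j) (fun i => momentCoeff_succ_zero C i j)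
      (fun r i => momentCoeff_succ_succ C i j) (-(N : ℂ)⁻¹) ?_
      (fun i => (N : ℂ) ^ (d + 1) * moment C i j)
      (fun i => contractLast (fun C i j => (N : ℂ) ^ d * moment C i j) C i j)
      (fun i => hasSum_contractLast (fun C i j => ih (by omega) C i j) C i j) (fun i => ?_) i
    -- The contraction condition is `d / N < 1`; this is where the stable range `d + 1 ≤ N` enters.
    · rw [norm_neg, norm_inv, Complex.norm_natCast, Fintype.card_fin, inv_mul_lt_iff₀
        (by positivity)]
      rw [mul_one]
      exact_mod_cast hd
    -- The fixed-point equation is `moment_succ` multiplied by `N ^ d`, solved for its first term.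
    · rw [contractLast_smul, ← moment_succ, ← Finset.mul_sum]
      field_simp
      ring

/-! ### Moments of the trace -/

lemma trace_mul_pow_eq_sum {N d : ℕ} (A X : Matrix (Fin N) (Fin N) ℂ) :
    (A * X).trace ^ d = ∑ i : Fin d → Fin N, ∑ j : Fin d → Fin N,
      (∏ k, A (j k) (i k)) * ∏ k, X (i k) (j k) := by
  have h : (A * X).trace = ∑ x : Fin N × Fin N, A x.2 x.1 * X x.1 x.2 := by
    rw [Fintype.sum_prod_type_right]
    simp [Matrix.trace, Matrix.mul_apply]
  rw [h, ← Fin.prod_const, Finset.prod_univ_sum, Fintype.piFinset_univ,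
    ← (Equiv.arrowProdEquivProdArrow (Fin d) (fun _ => Fin N) fun _ => Fin N).symm.sum_comp,
    Fintype.sum_prod_type]
  simp [Finset.prod_mul_distrib]

/-- The sum over `j` is forced to `j = i ∘ h ∘ σ`, and the remaining sum over `i` closes the `A`
factors into cycles. Reindexing by `h * σ` puts them in the order of its inverse. -/
lemma sum_prod_mul_permTraceSum {N d : ℕ} (A : Matrix (Fin N) (Fin N) ℂ)
    (C : Fin d → Matrix (Fin N) (Fin N) ℂ) (h : Perm (Fin d)) :
    ∑ i : Fin d → Fin N, ∑ j : Fin d → Fin N,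
      (∏ k, A (j k) (i k)) * permTraceSum C (i ∘ h) j =
    ∑ σ : Perm (Fin d), permTrace (h * σ)⁻¹ (fun _ => A) * permTrace σ C := by
  simp only [permTraceSum, Finset.mul_sum]
  have e1 : ∀ i : Fin d → Fin N, ∑ j : Fin d → Fin N, ∑ σ : Perm (Fin d),
      (∏ k, A (j k) (i k)) * (if (i ∘ h) ∘ σ = j then permTrace σ C else 0) =
      ∑ σ : Perm (Fin d), (∏ k, A (i ((h * σ) k)) (i k)) * permTrace σ C := by
    intro i
    rw [Finset.sum_comm]
    refine Finset.sum_congr rfl fun σ _ => ?_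
    simp
  simp only [e1]
  rw [Finset.sum_comm]
  refine Finset.sum_congr rfl fun σ _ => ?_
  rw [← Finset.sum_mul, permTrace]
  congr 1
  refine Finset.sum_congr rfl fun i _ => ?_
  rw [← Equiv.prod_comp (h * σ) fun x => A (i x) (i ((h * σ)⁻¹ x))]
  exact Finset.prod_congr rfl fun x _ => by rw [← Perm.mul_apply, inv_mul_cancel, Perm.one_apply]

/-- The expansion of the moments of `Tr (A U B U⁻¹)` in the stable range `d ≤ N`. -/
theorem hasSum_integral_trace_pow {N : ℕ} (hN : N ≠ 0) {d : ℕ} (hd : d ≤ N)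
    (A B : Matrix (Fin N) (Fin N) ℂ) :
    HasSum (fun r => (-(N : ℂ)⁻¹) ^ r * ∑ L ∈ monoLists (Fin d) r, ∑ σ : Perm (Fin d),
        permTrace (listProd L * σ)⁻¹ (fun _ => A) * permTrace σ (fun _ => B))
      ((N : ℂ) ^ d * ∫ U, (A * conjBy U B).trace ^ d ∂(haarUnitary N)) := by
  have e1 : (N : ℂ) ^ d * ∫ U, (A * conjBy U B).trace ^ d ∂(haarUnitary N) =
      ∑ i : Fin d → Fin N, ∑ j : Fin d → Fin N,
        (∏ k, A (j k) (i k)) * ((N : ℂ) ^ d * moment (fun _ => B) i j) := by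
    have hi : ∀ i j : Fin d → Fin N,
        Integrable (fun U => (∏ k, A (j k) (i k)) * ∏ k, conjBy U B (i k) (j k))
        (haarUnitary N) := fun i j => integrable_of_continuous
      (continuous_const.mul (continuous_finsetProd _ fun l _ => continuous_conjBy_apply _ _ _))
    simp only [trace_mul_pow_eq_sum]
    rw [integral_finsetSum _ fun i _ => integrable_finsetSum _ fun j _ => hi i j, Finset.mul_sum]
    refine Finset.sum_congr rfl fun i _ => ?_
    rw [integral_finsetSum _ fun j _ => hi i j, Finset.mul_sum]
    refine Finset.sum_congr rfl fun j _ => ?_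
    rw [integral_const_mul, mul_left_comm, moment]
  rw [e1]
  have e2 := hasSum_sum (s := Finset.univ) fun (i : Fin d → Fin N) _ =>
    hasSum_sum (s := Finset.univ) fun (j : Fin d → Fin N) _ =>
    (hasSum_momentCoeff hN hd (fun _ => B) i j).mul_left (∏ k, A (j k) (i k))
  refine e2.congr_fun fun r => ?_
  simp only [mul_left_comm _ ((-(N : ℂ)⁻¹) ^ r), ← Finset.mul_sum, momentCoeff]
  congr 1
  simp only [← sum_prod_mul_permTraceSum, Finset.mul_sum]
  rw [Finset.sum_comm]
  refine Finset.sum_congr rfl fun i _ => ?_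
  rw [Finset.sum_comm]

/-! ### Merging monotone lists -/

section filter
variable {α : Type*}

lemma map_val_injective {q : α → Prop} :
    Function.Injective (List.map (Prod.map (Subtype.val : {x // q x} → α)
      (Subtype.val : {x // q x} → α))) :=
  List.map_injective_iff.2 (Subtype.val_injective.prodMap Subtype.val_injective)

variable {p : α → Prop} [DecidablePred p] {L₁ : List ({x // p x} × {x // p x})}
  {L₂ : List ({x // ¬ p x} × {x // ¬ p x})}

lemma filter_map_val_pos :
    (L₁.map (Prod.map Subtype.val Subtype.val)).filter (fun q : α × α => p q.2) =
      L₁.map (Prod.map Subtype.val Subtype.val) := by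
  rw [List.filter_eq_self]
  simp only [List.forall_mem_map]
  exact fun q _ => decide_eq_true q.2.2

lemma filter_map_val_neg :
    (L₂.map (Prod.map Subtype.val Subtype.val)).filter (fun q : α × α => p q.2) = [] := by
  rw [List.filter_eq_nil_iff]
  simp only [List.forall_mem_map]
  intro q _ h
  exact q.2.2 (of_decide_eq_true h)

lemma filter_not_map_val_pos :
    (L₁.map (Prod.map Subtype.val Subtype.val)).filter (fun q : α × α => ¬ p q.2) = [] := by
  rw [List.filter_eq_nil_iff]
  simp only [List.forall_mem_map]
  intro q _ h
  exact of_decide_eq_true h q.2.2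

lemma filter_not_map_val_neg :
    (L₂.map (Prod.map Subtype.val Subtype.val)).filter (fun q : α × α => ¬ p q.2) =
      L₂.map (Prod.map Subtype.val Subtype.val) := by
  rw [List.filter_eq_self]
  simp only [List.forall_mem_map]
  exact fun q _ => decide_eq_true q.2.2

end filter

section merge
variable {α : Type*} [LinearOrder α]

/-- A monotone list is determined by the parts of it which move, respectively do not move, points
of a given set. -/
lemma IsMonoList.eq_of_filter_eq (p : α → Prop) [DecidablePred p] :
    ∀ {L L' : List (α × α)}, IsMonoList L → IsMonoList L' →
      L.filter (fun q => p q.2) = L'.filter (fun q => p q.2) →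
      L.filter (fun q => ¬ p q.2) = L'.filter (fun q => ¬ p q.2) → L = L'
  | [], [], _, _, _, _ => rfl
  | [], b :: L', _, _, h1, h2 => by
    by_cases hb : p b.2 <;> simp [hb] at h1 h2
  | a :: L, [], _, _, h1, h2 => by
    by_cases ha : p a.2 <;> simp [ha] at h1 h2
  | a :: L, b :: L', hL, hL', h1, h2 => by
    rw [isMonoList_cons] at hL hL'
    -- If exactly one head satisfies `p`, each head must reappear in the tail of the other list, so
    -- monotonicity gives both inequalities between `a.2` and `b.2`.
    have key : a.2 = b.2 ∨ (p a.2 ↔ p b.2) := by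
      by_contra hcon
      obtain ⟨hne, hiff⟩ := not_or.1 hcon
      by_cases ha : p a.2
      · have hb : ¬ p b.2 := fun hb => hiff (iff_of_true ha hb)
        have m1 : a ∈ L'.filter (fun q => p q.2) := by
          have : a ∈ (a :: L).filter (fun q => p q.2) := by simp [ha]
          rw [h1] at this; simpa [hb] using this
        have m2 : b ∈ L.filter (fun q => ¬ p q.2) := by
          have : b ∈ (b :: L').filter (fun q => ¬ p q.2) := by simp [hb]
          rw [← h2] at this; simpa [ha] using this
        exact hne (le_antisymm (hL'.2.1 a (List.mem_of_mem_filter m1))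
          (hL.2.1 b (List.mem_of_mem_filter m2)))
      · have hb : p b.2 := by by_contra hb; exact hiff (iff_of_false ha hb)
        have m1 : a ∈ L'.filter (fun q => ¬ p q.2) := by
          have : a ∈ (a :: L).filter (fun q => ¬ p q.2) := by simp [ha]
          rw [h2] at this; simpa [hb] using this
        have m2 : b ∈ L.filter (fun q => p q.2) := by
          have : b ∈ (b :: L').filter (fun q => p q.2) := by simp [hb]
          rw [← h1] at this; simpa [ha] using this
        exact hne (le_antisymm (hL'.2.1 a (List.mem_of_mem_filter m1))
          (hL.2.1 b (List.mem_of_mem_filter m2)))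
    have hiff : p a.2 ↔ p b.2 := by
      rcases key with h | h
      · rw [h]
      · exact h
    by_cases ha : p a.2
    · have hb := hiff.1 ha
      simp only [List.filter_cons, ha, hb, decide_true, if_true, List.cons.injEq, not_true,
        decide_false, Bool.false_eq_true, if_false] at h1 h2
      rw [h1.1, hL.2.2.eq_of_filter_eq p hL'.2.2 h1.2 h2]
    · have hb : ¬ p b.2 := fun h => ha (hiff.2 h)
      simp only [List.filter_cons, ha, hb, decide_true, if_true, List.cons.injEq,
        not_false_eq_true, decide_false, Bool.false_eq_true, if_false] at h1 h2
      rw [h2.1, hL.2.2.eq_of_filter_eq p hL'.2.2 h1 h2.2]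

variable (p : α → Prop)

/-- Merge a list on a set and a list on its complement, ordering by second components. -/
def mergeLists (L₁ : List ({x // p x} × {x // p x})) (L₂ : List ({x // ¬ p x} × {x // ¬ p x})) :
    List (α × α) :=
  (L₁.map (Prod.map Subtype.val Subtype.val) ++
    L₂.map (Prod.map Subtype.val Subtype.val)).mergeSort fun a b => decide (b.2 ≤ a.2)

variable {p} {L₁ : List ({x // p x} × {x // p x})} {L₂ : List ({x // ¬ p x} × {x // ¬ p x})}

lemma mergeLists_perm : (mergeLists p L₁ L₂).Perm (L₁.map (Prod.map Subtype.val Subtype.val) ++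
    L₂.map (Prod.map Subtype.val Subtype.val)) :=
  List.mergeSort_perm _ _

lemma sublist_mergeLists {c : List (α × α)} (hc : c.Pairwise fun p q => q.2 ≤ p.2)
    (h : c.Sublist (L₁.map (Prod.map Subtype.val Subtype.val) ++
      L₂.map (Prod.map Subtype.val Subtype.val))) : c.Sublist (mergeLists p L₁ L₂) :=
  List.sublist_mergeSort (fun a b c h1 h2 => by simp at *; exact h2.trans h1)
    (fun a b => by simpa using le_total _ _) (by simpa using hc) h

lemma length_mergeLists : (mergeLists p L₁ L₂).length = L₁.length + L₂.length := by
  rw [mergeLists_perm.length_eq]; simp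

lemma IsMonoList.map_val {q : α → Prop} {L : List ({x // q x} × {x // q x})} (h : IsMonoList L) :
    IsMonoList (L.map (Prod.map Subtype.val Subtype.val)) :=
  (isMonoList_map (Subtype.strictMono_coe _)).2 h

lemma isMonoList_mergeLists (h₁ : IsMonoList L₁) (h₂ : IsMonoList L₂) :
    IsMonoList (mergeLists p L₁ L₂) := by
  constructor
  · intro q hq
    rcases List.mem_append.1 (mergeLists_perm.mem_iff.1 hq) with h | h
    · exact h₁.map_val.1 q h
    · exact h₂.map_val.1 q h
  · have := List.pairwise_mergeSort (le := fun a b : α × α => decide (b.2 ≤ a.2))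
      (fun a b c h1 h2 => by simp at *; exact h2.trans h1)
      (fun a b => by simpa using le_total _ _)
      (L₁.map (Prod.map Subtype.val Subtype.val) ++ L₂.map (Prod.map Subtype.val Subtype.val))
    simpa [mergeLists] using this

lemma iff_of_mem_mergeLists {q : α × α} (hq : q ∈ mergeLists p L₁ L₂) : p q.1 ↔ p q.2 := by
  rcases List.mem_append.1 (mergeLists_perm.mem_iff.1 hq) with h | h
  · obtain ⟨a, -, rfl⟩ := List.mem_map.1 h
    exact iff_of_true a.1.2 a.2.2
  · obtain ⟨a, -, rfl⟩ := List.mem_map.1 h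
    exact iff_of_false a.1.2 a.2.2

variable [DecidablePred p]

/-- Sorting is stable, so the already sorted `L₁` survives as a sublist of the merge; comparing
lengths shows that the filter contains nothing else. -/
lemma filter_mergeLists (h : IsMonoList L₁) :
    (mergeLists p L₁ L₂).filter (fun q => p q.2) = L₁.map (Prod.map Subtype.val Subtype.val) := by
  symm
  refine List.Sublist.eq_of_length ?_ ?_
  · have := (sublist_mergeLists (L₁ := L₁) (L₂ := L₂) h.map_val.2
      (List.sublist_append_left _ _)).filter (fun q => p q.2)
    rwa [filter_map_val_pos] at this
  · rw [((mergeLists_perm (L₁ := L₁) (L₂ := L₂)).filter _).length_eq, List.filter_append,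
      filter_map_val_pos, filter_map_val_neg, List.append_nil]

lemma filter_not_mergeLists (h : IsMonoList L₂) :
    (mergeLists p L₁ L₂).filter (fun q => ¬ p q.2) =
      L₂.map (Prod.map Subtype.val Subtype.val) := by
  symm
  refine List.Sublist.eq_of_length ?_ ?_
  · have := (sublist_mergeLists (L₁ := L₁) (L₂ := L₂) h.map_val.2
      (List.sublist_append_right _ _)).filter (fun q => ¬ p q.2)
    rwa [filter_not_map_val_neg] at this
  · rw [((mergeLists_perm (L₁ := L₁) (L₂ := L₂)).filter _).length_eq, List.filter_append,
      filter_not_map_val_pos, filter_not_map_val_neg, List.nil_append]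

lemma IsMonoList.exists_mergeLists_eq {L : List (α × α)} (hL : IsMonoList L)
    (hp : ∀ q ∈ L, p q.1 ↔ p q.2) :
    ∃ L₁ L₂, IsMonoList L₁ ∧ IsMonoList L₂ ∧ mergeLists p L₁ L₂ = L := by
  have hval : ∀ (r : α → Prop) (M : List (α × α)), (∀ q ∈ M, r q.1 ∧ r q.2) →
      ∃ M' : List ({x // r x} × {x // r x}), M'.map (Prod.map Subtype.val Subtype.val) = M := by
    intro r M hM
    have : M ∈ Set.range (List.map (Prod.map (Subtype.val : {x // r x} → α)
        (Subtype.val : {x // r x} → α))) := by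
      rw [Set.range_list_map]
      exact fun q hq => ⟨(⟨q.1, (hM q hq).1⟩, ⟨q.2, (hM q hq).2⟩), rfl⟩
    exact this
  obtain ⟨L₁, h₁⟩ := hval p (L.filter fun q => p q.2) (by
    intro q hq
    have h := List.mem_filter.1 hq
    have h2 := of_decide_eq_true h.2
    exact ⟨(hp q h.1).2 h2, h2⟩)
  obtain ⟨L₂, h₂⟩ := hval (fun x => ¬ p x) (L.filter fun q => ¬ p q.2) (by
    intro q hq
    have h := List.mem_filter.1 hq
    have h2 := of_decide_eq_true h.2
    exact ⟨fun h3 => h2 ((hp q h.1).1 h3), h2⟩)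
  have hfilter : ∀ f : α × α → Bool, IsMonoList (L.filter f) := fun f =>
    ⟨fun q hq => hL.1 q (List.mem_of_mem_filter hq), hL.2.filter _⟩
  have m₁ : IsMonoList L₁ := by
    rw [← isMonoList_map (Subtype.strictMono_coe _), h₁]; exact hfilter _
  have m₂ : IsMonoList L₂ := by
    rw [← isMonoList_map (Subtype.strictMono_coe _), h₂]; exact hfilter _
  refine ⟨L₁, L₂, m₁, m₂, (isMonoList_mergeLists m₁ m₂).eq_of_filter_eq p hL ?_ ?_⟩
  · rw [filter_mergeLists m₁, h₁]
  · rw [filter_not_mergeLists m₂, h₂]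

/-- Sums over the monotone lists compatible with a set split. -/
lemma sum_monoLists_filter [Fintype α] (r : ℕ)
    (G : List (α × α) → ℂ) :
    ∑ L ∈ monoLists α r with (∀ q ∈ L, p q.1 ↔ p q.2), G L =
      ∑ ab ∈ Finset.HasAntidiagonal.antidiagonal r, ∑ L₁ ∈ monoLists {x // p x} ab.1,
        ∑ L₂ ∈ monoLists {x // ¬ p x} ab.2, G (mergeLists p L₁ L₂) := by
  simp only [← Finset.sum_product', Finset.sum_sigma']
  symm
  refine Finset.sum_bij (fun x _ => mergeLists p x.2.1 x.2.2) ?_ ?_ ?_ fun _ _ => rfl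
  · rintro ⟨⟨a, b⟩, L₁, L₂⟩ h
    simp only [Finset.mem_sigma, Finset.HasAntidiagonal.mem_antidiagonal, Finset.mem_product,
      mem_monoLists] at h
    rw [Finset.mem_filter, mem_monoLists, length_mergeLists]
    exact ⟨⟨by rw [h.2.1.1, h.2.2.1, h.1], isMonoList_mergeLists h.2.1.2 h.2.2.2⟩, fun q => iff_of_mem_mergeLists⟩
  · rintro ⟨⟨a, b⟩, L₁, L₂⟩ h ⟨⟨a', b'⟩, L₁', L₂'⟩ h' heq
    simp only [Finset.mem_sigma, Finset.HasAntidiagonal.mem_antidiagonal, Finset.mem_product,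
      mem_monoLists] at h h'
    simp only at heq
    have e1 := congrArg (List.filter fun q => p q.2) heq
    have e2 := congrArg (List.filter fun q => ¬ p q.2) heq
    rw [filter_mergeLists h.2.1.2, filter_mergeLists h'.2.1.2] at e1
    rw [filter_not_mergeLists h.2.2.2, filter_not_mergeLists h'.2.2.2] at e2
    obtain rfl := map_val_injective e1
    obtain rfl := map_val_injective e2
    have ha : a = a' := h.2.1.1.symm.trans h'.2.1.1
    have hb : b = b' := h.2.2.1.symm.trans h'.2.2.1
    rw [ha, hb]
  · intro L hL
    rw [Finset.mem_filter, mem_monoLists] at hL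
    obtain ⟨L₁, L₂, h₁, h₂, rfl⟩ := hL.1.2.exists_mergeLists_eq hL.2
    refine ⟨⟨(L₁.length, L₂.length), L₁, L₂⟩, ?_, rfl⟩
    simp only [Finset.mem_sigma, Finset.HasAntidiagonal.mem_antidiagonal, Finset.mem_product,
      mem_monoLists]
    rw [length_mergeLists] at hL
    exact ⟨hL.1.1, ⟨trivial, h₁⟩, trivial, h₂⟩

/-- Each transposition lies in one factor of the embedded product of the two symmetric groups, so
interleaving the lists does not affect the components of the product. -/
lemma listProd_eq_subtypeCongr : ∀ {L : List (α × α)} {L₁ : List ({x // p x} × {x // p x})}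
    {L₂ : List ({x // ¬ p x} × {x // ¬ p x})},
    (∀ q ∈ L, p q.1 ↔ p q.2) →
    L.filter (fun q => p q.2) = L₁.map (Prod.map Subtype.val Subtype.val) →
    L.filter (fun q => ¬ p q.2) = L₂.map (Prod.map Subtype.val Subtype.val) →
    listProd L = Perm.subtypeCongrHom p (listProd L₁, listProd L₂)
  | [], L₁, L₂, _, h1, h2 => by
    obtain rfl : L₁ = [] := List.map_eq_nil_iff.1 h1.symm
    obtain rfl : L₂ = [] := List.map_eq_nil_iff.1 h2.symm
    exact (map_one (Perm.subtypeCongrHom p)).symm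
  | q :: L, L₁, L₂, hp, h1, h2 => by
    rw [List.forall_mem_cons] at hp
    by_cases hq : p q.2
    · simp only [List.filter_cons, hq, decide_true, if_true, not_true,
        decide_false, Bool.false_eq_true, if_false] at h1 h2
      obtain ⟨q₁, L₁, rfl, rfl, h1'⟩ := List.map_eq_cons_iff.1 h1.symm
      rw [listProd_cons, listProd_eq_subtypeCongr hp.2 h1'.symm h2, listProd_cons]
      have : swap ((Prod.map Subtype.val Subtype.val q₁ : α × α)).1
          ((Prod.map Subtype.val Subtype.val q₁ : α × α)).2 =
          Perm.subtypeCongrHom p (swap q₁.1 q₁.2, 1) := by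
        ext x
        rw [Perm.subtypeCongrHom_apply]
        by_cases hx : p x
        · rw [Perm.subtypeCongr.left_apply _ _ hx]
          exact Subtype.val_injective.swap_apply q₁.1 q₁.2 ⟨x, hx⟩
        · rw [Perm.subtypeCongr.right_apply _ _ hx, swap_apply_of_ne_of_ne]
          · rfl
          · rintro rfl; exact hx q₁.1.2
          · rintro rfl; exact hx q₁.2.2
      rw [this, ← map_mul, Prod.mk_mul_mk, one_mul]
    · simp only [List.filter_cons, hq, decide_true, if_true, not_false_eq_true,
        decide_false, Bool.false_eq_true, if_false] at h1 h2
      obtain ⟨q₁, L₂, rfl, rfl, h2'⟩ := List.map_eq_cons_iff.1 h2.symm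
      rw [listProd_cons, listProd_eq_subtypeCongr hp.2 h1 h2'.symm, listProd_cons]
      have : swap ((Prod.map Subtype.val Subtype.val q₁ : α × α)).1
          ((Prod.map Subtype.val Subtype.val q₁ : α × α)).2 =
          Perm.subtypeCongrHom p (1, swap q₁.1 q₁.2) := by
        ext x
        rw [Perm.subtypeCongrHom_apply]
        by_cases hx : p x
        · rw [Perm.subtypeCongr.left_apply _ _ hx, swap_apply_of_ne_of_ne]
          · rfl
          · rintro rfl; exact q₁.1.2 hx
          · rintro rfl; exact q₁.2.2 hx
        · rw [Perm.subtypeCongr.right_apply _ _ hx]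
          exact Subtype.val_injective.swap_apply q₁.1 q₁.2 ⟨x, hx⟩
      rw [this, ← map_mul, Prod.mk_mul_mk, one_mul]

end merge

/-! ### Decomposition of factorizations into connected ones -/

section connected
variable {α : Type*}

/-- The set `p` is invariant under a permutation and under the transpositions of a list. -/
def IsInvariantUnder (p : α → Prop) (σ : Perm α) (L : List (α × α)) : Prop :=
  (∀ x, p (σ x) ↔ p x) ∧ ∀ q ∈ L, p q.1 ↔ p q.2

/-- The set `p` has no proper nonempty invariant subset. -/
def IsConnectedOn (p : α → Prop) (σ : Perm α) (L : List (α × α)) : Prop :=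
  ∀ T : α → Prop, (∃ x, T x) → (∀ x, T x → p x) → IsInvariantUnder T σ L → ∀ x, p x → T x

/-- There is no proper nonempty invariant subset. -/
def IsConnected (σ : Perm α) (L : List (α × α)) : Prop :=
  ∀ T : α → Prop, (∃ x, T x) → IsInvariantUnder T σ L → ∀ x, T x

lemma existsUnique_connectedOn [Fintype α] [DecidableEq α] (σ : Perm α) (L : List (α × α))
    (a : α) : ∃! S : Finset α, a ∈ S ∧ IsInvariantUnder (· ∈ S) σ L ∧
      IsConnectedOn (· ∈ S) σ L := by
  classical
  set S : Finset α := Finset.univ.filter fun x =>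
    ∀ T : α → Prop, T a → IsInvariantUnder T σ L → T x with hS
  have hmem : ∀ x, x ∈ S ↔ ∀ T : α → Prop, T a → IsInvariantUnder T σ L → T x := by
    intro x; simp [hS]
  have hinv : IsInvariantUnder (· ∈ S) σ L := by
    constructor
    · intro x
      simp only [hmem]
      exact forall₃_congr fun T _ hT => hT.1 x
    · intro q hq
      simp only [hmem]
      exact forall₃_congr fun T _ hT => hT.2 q hq
  have hconn : IsConnectedOn (· ∈ S) σ L := by
    rintro T ⟨y, hy⟩ hTS hT x hx
    -- If `T` misses `a`, its complement is an invariant set containing `a`, hence contains `S`,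
    -- which contradicts that `T` is a nonempty part of `S`.
    by_cases haT : T a
    · exact (hmem x).1 hx T haT hT
    · exact absurd hy ((hmem y).1 (hTS y hy) (fun z => ¬ T z) haT
        ⟨fun z => not_congr (hT.1 z), fun q hq => not_congr (hT.2 q hq)⟩)
  refine ⟨S, ⟨(hmem a).2 fun T h _ => h, hinv, hconn⟩, ?_⟩
  rintro S' ⟨haS', hinv', hconn'⟩
  refine Finset.Subset.antisymm ?_ ?_
  · intro x hx
    refine (hmem x).2 fun T haT hT => ?_
    refine (hconn' (fun z => T z ∧ z ∈ S') ⟨a, haT, haS'⟩ (fun z hz => hz.2)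
      ⟨fun z => and_congr (hT.1 z) (hinv'.1 z), fun q hq => and_congr (hT.2 q hq) (hinv'.2 q hq)⟩
      x hx).1
  · intro x hx
    exact (hmem x).1 hx _ haS' hinv'

lemma sum_perm_preserving [Fintype α] [DecidableEq α] (p : α → Prop) [DecidablePred p]
    [∀ σ : Perm α, Decidable (∀ x, p (σ x) ↔ p x)] (g : Perm α → ℂ) :
    ∑ σ : Perm α, (if ∀ x, p (σ x) ↔ p x then g σ else 0) =
      ∑ σ₁ : Perm {x // p x}, ∑ σ₂ : Perm {x // ¬ p x}, g (Perm.subtypeCongrHom p (σ₁, σ₂)) := by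
  rw [← Finset.sum_filter, ← Fintype.sum_prod_type' (f := fun σ₁ σ₂ =>
    g (Perm.subtypeCongrHom p (σ₁, σ₂)))]
  symm
  refine Finset.sum_bij (fun x _ => Perm.subtypeCongrHom p x) ?_ ?_ ?_ fun _ _ => rfl
  · rintro ⟨σ₁, σ₂⟩ -
    simp only [Finset.mem_filter, Finset.mem_univ, true_and, Perm.subtypeCongrHom_apply]
    intro x
    by_cases hx : p x
    · rw [Perm.subtypeCongr.left_apply _ _ hx]
      exact iff_of_true (σ₁ _).2 hx
    · rw [Perm.subtypeCongr.right_apply _ _ hx]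
      exact iff_of_false (σ₂ _).2 hx
  · intro x _ y _ h
    exact Perm.subtypeCongrHom_injective p h
  · intro σ hσ
    simp only [Finset.mem_filter, Finset.mem_univ, true_and] at hσ
    refine ⟨(σ.subtypePerm hσ, σ.subtypePerm fun x => not_congr (hσ x)), Finset.mem_univ _, ?_⟩
    ext x
    rw [Perm.subtypeCongrHom_apply]
    by_cases hx : p x
    · rw [Perm.subtypeCongr.left_apply _ _ hx]; rfl
    · rw [Perm.subtypeCongr.right_apply _ _ hx]; rfl

/-- Indices on the two invariant parts never meet, so both the sum and the product factor. -/
lemma permTrace_subtypeCongrHom {N : ℕ} [Fintype α] [DecidableEq α] (p : α → Prop)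
    [DecidablePred p] (σ₁ : Perm {x // p x}) (σ₂ : Perm {x // ¬ p x})
    (A : Matrix (Fin N) (Fin N) ℂ) :
    permTrace (Perm.subtypeCongrHom p (σ₁, σ₂)) (fun _ => A) =
      permTrace σ₁ (fun _ => A) * permTrace σ₂ (fun _ => A) := by
  rw [permTrace, permTrace, permTrace, Finset.sum_mul_sum,
    ← (Equiv.piEquivPiSubtypeProd p fun _ => Fin N).symm.sum_comp, Fintype.sum_prod_type]
  refine Finset.sum_congr rfl fun m₁ _ => Finset.sum_congr rfl fun m₂ _ => ?_
  rw [← Fintype.prod_subtype_mul_prod_subtype p]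
  congr 1
  · refine Finset.prod_congr rfl fun x _ => ?_
    rw [Perm.subtypeCongrHom_apply, Perm.subtypeCongr.left_apply_subtype]
    simp [Equiv.piEquivPiSubtypeProd, x.2, (σ₁ x).2]
  · refine Finset.prod_congr rfl fun x _ => ?_
    rw [Perm.subtypeCongrHom_apply, Perm.subtypeCongr.right_apply_subtype]
    simp [Equiv.piEquivPiSubtypeProd, x.2, (σ₂ x).2]

end connected

/-! ### Weighted factorizations and the exponential formula -/

section exponential
variable {N : ℕ} (A B : Matrix (Fin N) (Fin N) ℂ)

/-- The weight of the factorization `ρ σ = h`, where `h` is the product of the list. -/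
def weight {α : Type*} [Fintype α] [DecidableEq α] (L : List (α × α)) (σ : Perm α) : ℂ :=
  permTrace (listProd L * σ⁻¹) (fun _ => A) * permTrace σ (fun _ => B)

/-- The weighted number of monotone factorizations of length `r`. -/
def factorizationSum (α : Type*) [Fintype α] [LinearOrder α] (r : ℕ) : ℂ :=
  ∑ L ∈ monoLists α r, ∑ σ : Perm α, weight A B L σ

open Classical in
/-- The weighted number of connected monotone factorizations of length `r`. -/
def connectedSum (α : Type*) [Fintype α] [LinearOrder α] (r : ℕ) : ℂ :=
  ∑ L ∈ monoLists α r, ∑ σ : Perm α, if IsConnected σ L then weight A B L σ else 0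

lemma weight_mergeLists {α : Type*} [Fintype α] [LinearOrder α] (p : α → Prop) [DecidablePred p]
    {L₁ : List ({x // p x} × {x // p x})} {L₂ : List ({x // ¬ p x} × {x // ¬ p x})}
    (h₁ : IsMonoList L₁) (h₂ : IsMonoList L₂) (σ₁ : Perm {x // p x}) (σ₂ : Perm {x // ¬ p x}) :
    weight A B (mergeLists p L₁ L₂) (Perm.subtypeCongrHom p (σ₁, σ₂)) =
      weight A B L₁ σ₁ * weight A B L₂ σ₂ := by
  rw [weight, listProd_eq_subtypeCongr (fun q => iff_of_mem_mergeLists) (filter_mergeLists h₁)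
    (filter_not_mergeLists h₂), ← map_inv, ← map_mul, Prod.inv_mk, Prod.mk_mul_mk,
    permTrace_subtypeCongrHom, permTrace_subtypeCongrHom, weight, weight]
  ring

/-- Invariant subsets of `p` for the merged data are exactly the invariant subsets of the first
component, since the second component never touches `p`. -/
lemma isConnectedOn_mergeLists {α : Type*} [Fintype α] [LinearOrder α] (p : α → Prop)
    [DecidablePred p] (L₁ : List ({x // p x} × {x // p x}))
    (L₂ : List ({x // ¬ p x} × {x // ¬ p x})) (σ₁ : Perm {x // p x}) (σ₂ : Perm {x // ¬ p x}) :
    IsConnectedOn p (Perm.subtypeCongrHom p (σ₁, σ₂)) (mergeLists p L₁ L₂) ↔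
      IsConnected σ₁ L₁ := by
  have hmem : ∀ q : α × α, q ∈ mergeLists p L₁ L₂ ↔
      (∃ a ∈ L₁, Prod.map Subtype.val Subtype.val a = q) ∨
      ∃ a ∈ L₂, Prod.map Subtype.val Subtype.val a = q := by
    intro q
    rw [mergeLists_perm.mem_iff, List.mem_append, List.mem_map, List.mem_map]
  constructor
  · rintro h T ⟨x₀, hx₀⟩ hT x
    have := h (fun y => ∃ hy : p y, T ⟨y, hy⟩) ⟨x₀, x₀.2, hx₀⟩ (fun y hy => hy.1) ?_ x x.2
    · exact this.2
    · constructor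
      · intro y
        rw [Perm.subtypeCongrHom_apply]
        by_cases hy : p y
        · rw [Perm.subtypeCongr.left_apply _ _ hy]
          simp only [Subtype.coe_eta, hy, (σ₁ ⟨y, hy⟩).2, exists_true_left]
          exact hT.1 ⟨y, hy⟩
        · rw [Perm.subtypeCongr.right_apply _ _ hy]
          exact iff_of_false (fun h => (σ₂ ⟨y, hy⟩).2 h.1) fun h => hy h.1
      · intro q hq
        rcases (hmem q).1 hq with ⟨a, ha, rfl⟩ | ⟨a, ha, rfl⟩
        · simp only [Prod.map_fst, Prod.map_snd, Subtype.coe_eta, a.1.2, a.2.2, exists_true_left]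
          exact hT.2 a ha
        · exact iff_of_false (fun h => a.1.2 h.1) fun h => a.2.2 h.1
  · rintro h T ⟨x₀, hx₀⟩ hTp hT x hx
    refine h (fun y => T y) ⟨⟨x₀, hTp _ hx₀⟩, hx₀⟩ ⟨fun y => ?_, fun q hq => ?_⟩ ⟨x, hx⟩
    · have := hT.1 y
      rwa [Perm.subtypeCongrHom_apply, Perm.subtypeCongr.left_apply_subtype] at this
    · exact hT.2 _ ((hmem _).2 (Or.inl ⟨q, hq, rfl⟩))

-- Once `p` is invariant, both the permutation and the list split along `p`. Unique merging and
-- multiplicativity of the weight give a convolution in the length, with connectedness imposed only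
-- on the `p` part.
open Classical in
lemma sum_invariant_connectedOn {α : Type*} [Fintype α] [LinearOrder α] (p : α → Prop)
    [DecidablePred p] (r : ℕ) :
    ∑ L ∈ monoLists α r, ∑ σ : Perm α,
        (if IsInvariantUnder p σ L ∧ IsConnectedOn p σ L then weight A B L σ else 0) =
      ∑ ab ∈ Finset.HasAntidiagonal.antidiagonal r,
        connectedSum A B {x // p x} ab.1 * factorizationSum A B {x // ¬ p x} ab.2 := by
  have e1 : ∀ L : List (α × α), ∑ σ : Perm α,
      (if IsInvariantUnder p σ L ∧ IsConnectedOn p σ L then weight A B L σ else 0) =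
      if (∀ q ∈ L, p q.1 ↔ p q.2) then ∑ σ₁ : Perm {x // p x}, ∑ σ₂ : Perm {x // ¬ p x},
        (if IsConnectedOn p (Perm.subtypeCongrHom p (σ₁, σ₂)) L then
          weight A B L (Perm.subtypeCongrHom p (σ₁, σ₂)) else 0) else 0 := by
    intro L
    split_ifs with hL
    · rw [← sum_perm_preserving p fun σ => if IsConnectedOn p σ L then weight A B L σ else 0]
      refine Finset.sum_congr rfl fun σ _ => ?_
      simp only [IsInvariantUnder, and_iff_left hL, ite_and]
    · refine Finset.sum_eq_zero fun σ _ => if_neg fun h => hL h.1.2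
  simp only [e1]
  rw [← Finset.sum_filter, sum_monoLists_filter]
  refine Finset.sum_congr rfl fun ab _ => ?_
  rw [connectedSum, factorizationSum, Finset.sum_mul_sum]
  refine Finset.sum_congr rfl fun L₁ h₁ => Finset.sum_congr rfl fun L₂ h₂ => ?_
  rw [Finset.sum_mul_sum]
  refine Finset.sum_congr rfl fun σ₁ _ => Finset.sum_congr rfl fun σ₂ _ => ?_
  simp only [isConnectedOn_mergeLists, ite_mul, zero_mul]
  split_ifs
  · exact weight_mergeLists A B p (mem_monoLists.1 h₁).2 (mem_monoLists.1 h₂).2 σ₁ σ₂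
  · rfl

/-- Decomposition of factorizations according to the orbit of a given point. -/
lemma factorizationSum_eq_sum_finset {α : Type*} [Fintype α] [LinearOrder α] (a : α) (r : ℕ) :
    factorizationSum A B α r = ∑ S : Finset α with a ∈ S,
      ∑ ab ∈ Finset.HasAntidiagonal.antidiagonal r,
        connectedSum A B {x // x ∈ S} ab.1 * factorizationSum A B {x // x ∉ S} ab.2 := by
  classical
  have key : ∀ S : Finset α, ∑ ab ∈ Finset.HasAntidiagonal.antidiagonal r,
        connectedSum A B {x // x ∈ S} ab.1 * factorizationSum A B {x // x ∉ S} ab.2 =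
      ∑ L ∈ monoLists α r, ∑ σ : Perm α, (if IsInvariantUnder (· ∈ S) σ L ∧
        IsConnectedOn (· ∈ S) σ L then weight A B L σ else 0) := by
    intro S
    convert (sum_invariant_connectedOn A B (· ∈ S) r).symm
  simp only [key]
  symm
  rw [Finset.sum_comm, factorizationSum]
  refine Finset.sum_congr rfl fun L _ => ?_
  rw [Finset.sum_comm]
  refine Finset.sum_congr rfl fun σ _ => ?_
  -- The connected component of `a` is the only set counted for this factorization.
  obtain ⟨S, hS, huniq⟩ := existsUnique_connectedOn σ L a
  rw [Finset.sum_eq_single S]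
  · rw [if_pos hS.2]
  · intro S' hS' hne
    rw [if_neg]
    exact fun h => hne (huniq S' ⟨(Finset.mem_filter.1 hS').2, h⟩)
  · intro h
    exact (h (Finset.mem_filter.2 ⟨Finset.mem_univ S, hS.1⟩)).elim

/-! ### Invariance under order isomorphisms -/

lemma listProd_map {α β : Type*} [DecidableEq α] [DecidableEq β] (e : α ≃ β) (L : List (α × α)) :
    listProd (L.map (Prod.map e e)) = e.permCongr (listProd L) := by
  induction L with
  | nil => ext; simp
  | cons q L ih =>
    rw [List.map_cons, listProd_cons, ih, listProd_cons]
    ext x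
    simp [Equiv.permCongr_apply, e.injective.swap_apply]

lemma isConnected_congr {α β : Type*} (e : α ≃ β) (L : List (α × α)) (σ : Perm α) :
    IsConnected (e.permCongr σ) (L.map (Prod.map e e)) ↔ IsConnected σ L := by
  constructor
  · rintro h T ⟨x₀, hx₀⟩ hT x
    have := h (fun y => T (e.symm y)) ⟨e x₀, by simpa using hx₀⟩ ⟨fun y => ?_, ?_⟩ (e x)
    · simpa using this
    · simpa [Equiv.permCongr_apply] using hT.1 (e.symm y)
    · simp only [List.forall_mem_map]
      intro q hq
      simpa using hT.2 q hq
  · rintro h T ⟨x₀, hx₀⟩ hT x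
    have := h (fun y => T (e y)) ⟨e.symm x₀, by simpa using hx₀⟩ ⟨fun y => ?_, ?_⟩ (e.symm x)
    · simpa using this
    · simpa [Equiv.permCongr_apply] using hT.1 (e y)
    · intro q hq
      simpa using hT.2 _ (List.mem_map_of_mem hq)

lemma permTrace_permCongr {α β : Type*} [Fintype α] [DecidableEq α] [Fintype β]
    [DecidableEq β] (e : α ≃ β) (σ : Perm α) :
    permTrace (e.permCongr σ) (fun _ => A) = permTrace σ (fun _ => A) := by
  rw [permTrace, permTrace, ← (e.arrowCongr (Equiv.refl (Fin N))).sum_comp]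
  refine Finset.sum_congr rfl fun m _ => ?_
  rw [← Equiv.prod_comp e]
  simp

section congr
variable {α β : Type*} [Fintype α] [LinearOrder α] [Fintype β] [LinearOrder β]

lemma weight_congr (e : α ≃ β) (L : List (α × α)) (σ : Perm α) :
    weight A B (L.map (Prod.map e e)) (e.permCongr σ) = weight A B L σ := by
  rw [weight, listProd_map, weight, permTrace_permCongr, ← permTrace_permCongr A e]
  rw [Equiv.permCongr_mul]
  rfl

/-- Monotonicity depends on the linear order, so the relabelling must preserve it; any finite linear
order is nevertheless isomorphic to `Fin` of its cardinality. -/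
lemma sum_monoLists_congr (e : α ≃o β) (r : ℕ) (G : List (β × β) → ℂ) :
    ∑ L ∈ monoLists β r, G L = ∑ L ∈ monoLists α r, G (L.map (Prod.map e e)) := by
  symm
  refine Finset.sum_nbij' (List.map (Prod.map e e)) (List.map (Prod.map e.symm e.symm))
    ?_ ?_ ?_ ?_ fun _ _ => rfl
  · intro L hL
    rw [mem_monoLists] at hL ⊢
    exact ⟨by simpa using hL.1, (isMonoList_map e.strictMono).2 hL.2⟩
  · intro L hL
    rw [mem_monoLists] at hL ⊢
    exact ⟨by simpa using hL.1, (isMonoList_map e.symm.strictMono).2 hL.2⟩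
  · intro L _
    rw [List.map_map]
    convert List.map_id L
    ext q <;> simp
  · intro L _
    rw [List.map_map]
    convert List.map_id L
    ext q <;> simp

lemma factorizationSum_congr (e : α ≃o β) (r : ℕ) :
    factorizationSum A B β r = factorizationSum A B α r := by
  rw [factorizationSum, factorizationSum, sum_monoLists_congr e]
  refine Finset.sum_congr rfl fun L _ => ?_
  rw [← (e.toEquiv.permCongr).sum_comp]
  exact Finset.sum_congr rfl fun σ _ => weight_congr A B e.toEquiv L σ

lemma connectedSum_congr (e : α ≃o β) (r : ℕ) :
    connectedSum A B β r = connectedSum A B α r := by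
  classical
  rw [connectedSum, connectedSum, sum_monoLists_congr e]
  refine Finset.sum_congr rfl fun L _ => ?_
  rw [← (e.toEquiv.permCongr).sum_comp]
  refine Finset.sum_congr rfl fun σ _ => ?_
  have h1 := weight_congr A B e.toEquiv L σ
  have h2 := isConnected_congr e.toEquiv L σ
  exact if_congr h2 h1 rfl

end congr

/-! ### The exponential recursion -/

/-- The recursion relating all factorizations to connected ones. -/
lemma factorizationSum_fin_succ (n r : ℕ) :
    factorizationSum A B (Fin (n + 1)) r = ∑ k ∈ Finset.range (n + 1), (n.choose k : ℂ) *
      ∑ ab ∈ Finset.HasAntidiagonal.antidiagonal r,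
        connectedSum A B (Fin (k + 1)) ab.1 * factorizationSum A B (Fin (n - k)) ab.2 := by
  rw [factorizationSum_eq_sum_finset A B (0 : Fin (n + 1))]
  have e1 : ∀ (S : Finset (Fin (n + 1))), 0 ∈ S →
      ∑ ab ∈ Finset.HasAntidiagonal.antidiagonal r,
        connectedSum A B {x // x ∈ S} ab.1 * factorizationSum A B {x // x ∉ S} ab.2 =
      ∑ ab ∈ Finset.HasAntidiagonal.antidiagonal r,
        connectedSum A B (Fin ((S.erase 0).card + 1)) ab.1 *
        factorizationSum A B (Fin (n - (S.erase 0).card)) ab.2 := by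
    intro S hS
    have h1 : Fintype.card {x // x ∈ S} = (S.erase 0).card + 1 := by
      rw [Fintype.card_coe, Finset.card_erase_add_one hS]
    have h2 : Fintype.card {x // x ∉ S} = n - (S.erase 0).card := by
      rw [Fintype.card_subtype_compl, Fintype.card_fin, h1]; omega
    refine Finset.sum_congr rfl fun ab _ => ?_
    rw [connectedSum_congr A B (Fintype.orderIsoFinOfCardEq _ h1),
      factorizationSum_congr A B (Fintype.orderIsoFinOfCardEq _ h2)]
  -- The component `S` of `0` enters only through `k = |S| - 1`, and `S` without `0` ranges over the
  -- subsets of `n` points; hence the binomial coefficient.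
  have h := Finset.sum_powerset_apply_card (fun k =>
    ∑ ab ∈ Finset.HasAntidiagonal.antidiagonal r,
        connectedSum A B (Fin (k + 1)) ab.1 * factorizationSum A B (Fin (n - k)) ab.2)
    (x := (Finset.univ : Finset (Fin (n + 1))).erase 0)
  rw [Finset.card_erase_of_mem (Finset.mem_univ _), Finset.card_univ, Fintype.card_fin,
    Nat.add_sub_cancel] at h
  simp only [nsmul_eq_mul] at h
  rw [← h]
  refine Finset.sum_bij' (fun S _ => S.erase 0) (fun T _ => insert 0 T) ?_ ?_ ?_ ?_ ?_
  · intro S _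
    exact Finset.mem_powerset.2 (Finset.erase_subset_erase _ (Finset.subset_univ _))
  · intro T _; simp
  · intro S hS
    exact Finset.insert_erase (Finset.mem_filter.1 hS).2
  · intro T hT
    refine Finset.erase_insert fun h0 => ?_
    exact Finset.notMem_erase _ _ (Finset.mem_powerset.1 hT h0)
  · intro S hS
    exact e1 S (Finset.mem_filter.1 hS).2

end exponential

/-! ### Traces of permutation operators and cycle types -/

section cycles
variable {N : ℕ}

/-- A long cycle arises from a shorter one by inserting the last point, the shape needed by
`permTrace_extendLast_mul_swap`. -/
lemma finRotate_add_two (n : ℕ) :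
    finRotate (n + 2) = extendLast (finRotate (n + 1)) *
      swap (Fin.last n).castSucc (Fin.last (n + 1)) := by
  ext x
  rw [Perm.mul_apply]
  induction x using Fin.lastCases with
  | last => rw [swap_apply_right, extendLast_castSucc, finRotate_last, finRotate_last]; rfl
  | cast x =>
    rw [coe_finRotate_of_ne_last (Fin.castSucc_lt_last x).ne]
    by_cases hx : x = Fin.last n
    · subst hx
      rw [swap_apply_left, extendLast_last]; simp
    · rw [swap_apply_of_ne_of_ne (fun h => hx (Fin.castSucc_injective _ h))
        (Fin.castSucc_lt_last x).ne, extendLast_castSucc, Fin.val_castSucc, Fin.val_castSucc,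
        coe_finRotate_of_ne_last hx]

/-- A general power is kept in the last slot so that the induction closes: removing the last point
merges its matrix into the preceding slot. -/
lemma permTrace_finRotate_update (A : Matrix (Fin N) (Fin N) ℂ) (n m : ℕ) :
    permTrace (finRotate (n + 1)) (Function.update (fun _ => A) (Fin.last n) (A ^ m)) =
      (A ^ (n + m)).trace := by
  induction n generalizing m with
  | zero =>
    rw [permTrace, ← (Equiv.funUnique (Fin 1) (Fin N)).symm.sum_comp]
    simp [Matrix.trace, finRotate_one]
  | succ n ih =>
    rw [finRotate_add_two, permTrace_extendLast_mul_swap]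
    rw [Function.update_self, Function.update_of_ne (Fin.castSucc_lt_last _).ne, ← pow_succ',
      show n + 1 + m = n + (m + 1) by ring, ← ih (m + 1)]
    congr 2
    ext x : 1
    rw [Function.comp_apply, Function.update_of_ne (Fin.castSucc_lt_last _).ne]

lemma permTrace_finRotate (A : Matrix (Fin N) (Fin N) ℂ) (n : ℕ) :
    permTrace (finRotate (n + 1)) (fun _ => A) = (A ^ (n + 1)).trace := by
  have := permTrace_finRotate_update A n 1
  rwa [pow_one, Function.update_eq_self] at this

lemma permTrace_of_sameCycle {α : Type*} [Fintype α] [DecidableEq α] [Nonempty α] {σ : Perm α}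
    (h : ∀ x y, σ.SameCycle x y) (A : Matrix (Fin N) (Fin N) ℂ) :
    permTrace σ (fun _ => A) = (A ^ Fintype.card α).trace := by
  obtain ⟨n, hn⟩ : ∃ n, Fintype.card α = n + 1 :=
    Nat.exists_eq_succ_of_ne_zero Fintype.card_ne_zero
  have hc : σ.IsCycleOn ((Finset.univ : Finset α) : Set α) :=
    ⟨by rw [Finset.coe_univ]; exact Set.bijOn_univ.2 σ.bijective, fun x _ y _ => h x y⟩
  let a : α := Classical.arbitrary α
  have hsurj : Function.Surjective fun k : Fin (n + 1) => (σ ^ (k : ℕ)) a := by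
    intro y
    obtain ⟨k, hk, hky⟩ := hc.exists_pow_eq (Finset.mem_univ a) (Finset.mem_univ y)
    rw [Finset.card_univ, hn] at hk
    exact ⟨⟨k, hk⟩, hky⟩
  have hbij := (Fintype.bijective_iff_surjective_and_card _).2 ⟨hsurj, by simp [hn]⟩
  let e := Equiv.ofBijective _ hbij
  have he : e.permCongr (finRotate (n + 1)) = σ := by
    ext x
    obtain ⟨k, rfl⟩ := e.surjective x
    rw [Equiv.permCongr_apply, Equiv.symm_apply_apply]
    change (σ ^ ((finRotate (n + 1) k : Fin (n + 1)) : ℕ)) a = σ ((σ ^ (k : ℕ)) a)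
    rw [← Perm.mul_apply, ← pow_succ']
    by_cases hk : k = Fin.last n
    · subst hk
      rw [finRotate_last, Fin.val_last]
      have := hc.pow_card_apply (Finset.mem_univ a)
      rw [Finset.card_univ, hn] at this
      rw [this]; rfl
    · rw [coe_finRotate_of_ne_last hk]
  rw [← he, permTrace_permCongr, permTrace_finRotate, hn]

lemma parts_partition_of_sameCycle {α : Type*} [Fintype α] [DecidableEq α] [Nonempty α]
    {σ : Perm α} (h : ∀ x y, σ.SameCycle x y) : σ.partition.parts = {Fintype.card α} := by
  rw [Perm.parts_partition]
  rcases subsingleton_or_nontrivial α with hα | hα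
  · have : σ = 1 := Subsingleton.elim _ _
    have hcard : Fintype.card α = 1 := Fintype.card_eq_one_iff_nonempty_unique.2
      ⟨⟨⟨Classical.arbitrary α⟩, fun _ => Subsingleton.elim _ _⟩⟩
    simp [this, hcard]
  · have hc : σ.IsCycleOn (Set.univ : Set α) :=
      ⟨Set.bijOn_univ.2 σ.bijective, fun x _ y _ => h x y⟩
    have hne : ∀ x, σ x ≠ x := fun x => hc.apply_ne Set.nontrivial_univ (Set.mem_univ x)
    have hsupp : σ.support = Finset.univ := by ext x; simp [hne]
    have hcyc : σ.IsCycle := ⟨Classical.arbitrary α, hne _, fun y _ => h _ y⟩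
    rw [hcyc.cycleType, hsupp, Finset.card_univ]
    simp

/-- `cycleType` is additive on disjoint permutations but omits fixed points; these are recovered
from the cardinalities of the two parts. -/
lemma parts_partition_subtypeCongrHom {α : Type*} [Fintype α] [DecidableEq α] (p : α → Prop)
    [DecidablePred p] (σ₁ : Perm {x // p x}) (σ₂ : Perm {x // ¬ p x}) :
    (Perm.subtypeCongrHom p (σ₁, σ₂)).partition.parts =
      σ₁.partition.parts + σ₂.partition.parts := by
  have e1 : Perm.subtypeCongrHom p (σ₁, σ₂) = Perm.ofSubtype σ₁ * Perm.ofSubtype σ₂ := by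
    ext x
    rw [Perm.subtypeCongrHom_apply, Perm.mul_apply]
    by_cases hx : p x
    · rw [Perm.subtypeCongr.left_apply _ _ hx, Perm.ofSubtype_apply_of_not_mem σ₂ (not_not.2 hx),
        Perm.ofSubtype_apply_of_mem σ₁ hx]
    · rw [Perm.subtypeCongr.right_apply _ _ hx, Perm.ofSubtype_apply_of_mem σ₂ hx,
        Perm.ofSubtype_apply_of_not_mem σ₁ (σ₂ _).2]
  have e2 : Perm.Disjoint (Perm.ofSubtype σ₁) (Perm.ofSubtype σ₂) := by
    intro x
    by_cases hx : p x
    · exact Or.inr (Perm.ofSubtype_apply_of_not_mem σ₂ (not_not.2 hx))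
    · exact Or.inl (Perm.ofSubtype_apply_of_not_mem σ₁ hx)
  have e3 : (Perm.subtypeCongrHom p (σ₁, σ₂)).cycleType = σ₁.cycleType + σ₂.cycleType := by
    rw [e1, e2.cycleType_mul, Perm.cycleType_ofSubtype, Perm.cycleType_ofSubtype]
  have e4 : (Perm.subtypeCongrHom p (σ₁, σ₂)).support.card =
      σ₁.support.card + σ₂.support.card := by
    simp only [← Perm.sum_cycleType, e3, Multiset.sum_add]
  have h1 : σ₁.support.card ≤ Fintype.card {x // p x} := Finset.card_le_univ _
  have h2 : σ₂.support.card ≤ Fintype.card {x // ¬ p x} := Finset.card_le_univ _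
  have h3 : Fintype.card α = Fintype.card {x // p x} + Fintype.card {x // ¬ p x} := by
    rw [← Fintype.card_sum]; exact Fintype.card_congr (Equiv.sumCompl p).symm
  have e5 : Fintype.card α - (Perm.subtypeCongrHom p (σ₁, σ₂)).support.card =
      (Fintype.card {x // p x} - σ₁.support.card) +
      (Fintype.card {x // ¬ p x} - σ₂.support.card) := by omega
  rw [Perm.parts_partition, Perm.parts_partition, Perm.parts_partition, e3, e5,
    Multiset.replicate_add]
  abel

/-- The trace of a permutation operator times `A ⊗ ⋯ ⊗ A` is a power sum. -/
theorem permTrace_eq_prod_parts (A : Matrix (Fin N) (Fin N) ℂ) {α : Type*} [Fintype α]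
    [DecidableEq α] (σ : Perm α) :
    permTrace σ (fun _ => A) = (σ.partition.parts.map fun k => (A ^ k).trace).prod := by
  suffices H : ∀ (n : ℕ) (α : Type _) [Fintype α] [DecidableEq α] (σ : Perm α),
      Fintype.card α = n →
      permTrace σ (fun _ => A) = (σ.partition.parts.map fun k => (A ^ k).trace).prod from
    H _ α σ rfl
  intro n
  induction n using Nat.strong_induction_on with
  | _ n ih =>
    intro α _ _ σ hn
    rcases isEmpty_or_nonempty α with hα | ⟨⟨a⟩⟩
    · have : σ.partition.parts = 0 := by
        rw [Perm.parts_partition]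
        simp [Subsingleton.elim σ 1]
      rw [this, permTrace]
      simp
    · classical
      -- The cycle through `a` is split off, and the induction hypothesis is applied to its
      -- complement.
      let p : α → Prop := σ.SameCycle a
      have hp : ∀ x, p (σ x) ↔ p x := fun x => Perm.sameCycle_apply_right
      have hp' : ∀ x, ¬ p (σ x) ↔ ¬ p x := fun x => not_congr (hp x)
      have hσ : σ = Perm.subtypeCongrHom p (σ.subtypePerm hp, σ.subtypePerm hp') := by
        ext x
        rw [Perm.subtypeCongrHom_apply]
        by_cases hx : p x
        · rw [Perm.subtypeCongr.left_apply _ _ hx]; rfl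
        · rw [Perm.subtypeCongr.right_apply _ _ hx]; rfl
      have hsame : ∀ x y, (σ.subtypePerm hp).SameCycle x y := fun x y =>
        Perm.sameCycle_subtypePerm.2 (x.2.symm.trans y.2)
      have : Nonempty {x // p x} := ⟨⟨a, Perm.SameCycle.refl _ _⟩⟩
      have hlt : Fintype.card {x // ¬ p x} < n := by
        rw [← hn]
        exact Fintype.card_subtype_lt (x := a) (not_not.2 (Perm.SameCycle.refl _ _))
      rw [hσ, permTrace_subtypeCongrHom, parts_partition_subtypeCongrHom, Multiset.map_add,
        Multiset.prod_add, parts_partition_of_sameCycle hsame, Multiset.map_singleton,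
        Multiset.prod_singleton]
      congr 1
      · exact permTrace_of_sameCycle hsame A
      · exact ih _ hlt {x // ¬ p x} (σ.subtypePerm hp') rfl

end cycles

/-! ### The Riemann–Hurwitz inequality -/

section genus
variable {α : Type*}

/-- The functions to `𝔽₂` invariant under a permutation. -/
def fixedFunctions (σ : Perm α) : Submodule (ZMod 2) (α → ZMod 2) where
  carrier := {v | ∀ x, v (σ x) = v x}
  zero_mem' := fun _ => rfl
  add_mem' := fun {v w} hv hw x => by simp [hv x, hw x]
  smul_mem' := fun c v hv x => by simp [hv x]

lemma mem_fixedFunctions {σ : Perm α} {v : α → ZMod 2} :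
    v ∈ fixedFunctions σ ↔ ∀ x, v (σ x) = v x := Iff.rfl

/-- The functions to `𝔽₂` invariant under a permutation and the transpositions of a list. -/
def fixedFunctionsList (σ : Perm α) (L : List (α × α)) : Submodule (ZMod 2) (α → ZMod 2) where
  carrier := {v | (∀ x, v (σ x) = v x) ∧ ∀ q ∈ L, v q.1 = v q.2}
  zero_mem' := ⟨fun _ => rfl, fun _ _ => rfl⟩
  add_mem' := fun {v w} hv hw =>
    ⟨fun x => by simp [hv.1 x, hw.1 x], fun q hq => by simp [hv.2 q hq, hw.2 q hq]⟩
  smul_mem' := fun c v hv => ⟨fun x => by simp [hv.1 x], fun q hq => by simp [hv.2 q hq]⟩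

lemma mem_fixedFunctionsList {σ : Perm α} {L : List (α × α)} {v : α → ZMod 2} :
    v ∈ fixedFunctionsList σ L ↔ (∀ x, v (σ x) = v x) ∧ ∀ q ∈ L, v q.1 = v q.2 := Iff.rfl

/-- The linear form `v ↦ v s - v t`. -/
def difference (s t : α) : (α → ZMod 2) →ₗ[ZMod 2] ZMod 2 :=
  LinearMap.proj (R := ZMod 2) (φ := fun _ : α => ZMod 2) s -
    LinearMap.proj (R := ZMod 2) (φ := fun _ : α => ZMod 2) t

lemma mem_ker_difference {s t : α} {v : α → ZMod 2} :
    v ∈ LinearMap.ker (difference s t) ↔ v s = v t := by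
  simp [difference, sub_eq_zero]

/-- One linear equation lowers the dimension by at most one. -/
lemma finrank_le_finrank_inf_ker [Finite α] (S : Submodule (ZMod 2) (α → ZMod 2)) (s t : α) :
    Module.finrank (ZMod 2) S ≤
      Module.finrank (ZMod 2) (S ⊓ LinearMap.ker (difference s t) : Submodule _ _) + 1 := by
  have h1 := ((difference s t).domRestrict S).finrank_range_add_finrank_ker
  have h2 : Module.finrank (ZMod 2) (LinearMap.range ((difference s t).domRestrict S)) ≤ 1 :=
    (Submodule.finrank_le _).trans (by simp)
  have h3 : Module.finrank (ZMod 2) (LinearMap.ker ((difference s t).domRestrict S)) ≤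
      Module.finrank (ZMod 2) (S ⊓ LinearMap.ker (difference s t) : Submodule _ _) := by
    rw [← Submodule.finrank_map_subtype_eq]
    refine Submodule.finrank_mono ?_
    rintro _ ⟨x, hx, rfl⟩
    exact ⟨x.2, hx⟩
  omega

lemma IsConnected.inv {σ : Perm α} {L : List (α × α)} (h : IsConnected σ L) :
    IsConnected σ⁻¹ L := by
  intro T hT hinv
  refine h T hT ⟨fun x => ?_, hinv.2⟩
  have := hinv.1 (σ x)
  rw [← Perm.mul_apply, inv_mul_cancel, Perm.one_apply] at this
  exact this.symm

/-- The level sets of an invariant function are invariant, so connectedness makes the function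
constant. -/
lemma finrank_fixedFunctionsList_le_one [Fintype α] [Nonempty α] {σ : Perm α}
    {L : List (α × α)} (h : IsConnected σ L) :
    Module.finrank (ZMod 2) (fixedFunctionsList σ L) ≤ 1 := by
  have hle : fixedFunctionsList σ L ≤ Submodule.span (ZMod 2) {fun _ => 1} := by
    intro v hv
    let a : α := Classical.arbitrary α
    have hT := h (fun x => v x = v a) ⟨a, rfl⟩
      ⟨fun x => by simp only [hv.1 x], fun q hq => by simp only [hv.2 q hq]⟩
    rw [Submodule.mem_span_singleton]
    exact ⟨v a, by ext x; simp [hT x]⟩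
  exact (Submodule.finrank_mono hle).trans (finrank_span_le_card _ |>.trans (by simp))

variable [DecidableEq α]

lemma fixedFunctionsList_le (σ : Perm α) (L : List (α × α)) :
    fixedFunctionsList σ L ≤ fixedFunctions (listProd L * σ) := by
  induction L with
  | nil =>
    intro v hv
    rw [listProd_nil, one_mul]
    exact hv.1
  | cons q L ih =>
    intro v hv
    have h1 := ih ⟨hv.1, fun q' hq' => hv.2 q' (List.mem_cons_of_mem _ hq')⟩
    have h2 := hv.2 q List.mem_cons_self
    intro x
    rw [listProd_cons, mul_assoc, Perm.mul_apply, ← h1 x]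
    rw [swap_apply_def]
    split_ifs with h3 h4
    · rw [h3, h2]
    · rw [h4, h2]
    · rfl

/-- Joining two cycles by a transposition. -/
lemma fixedFunctions_swap_mul_le [Fintype α] {π : Perm α} {s t : α} {v : α → ZMod 2}
    (hv : v ∈ fixedFunctions π) (hst : v s ≠ v t) :
    fixedFunctions (swap s t * π) ≤ fixedFunctions π ⊓ LinearMap.ker (difference s t) := by
  intro u hu
  -- The set where `v = v s` is invariant under `π` and contains `s` but not `t`. Summing `u (swap s
  -- t (π x)) = u x` over it, every term cancels except `u t` against `u s`.
  have key : u s = u t := by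
    have h1 : ∑ x with v x = v s, u (swap s t (π x)) = ∑ x with v x = v s, u x :=
      Finset.sum_congr rfl fun x _ => hu x
    have h2 : ∑ x with v x = v s, u (swap s t (π x)) = ∑ x with v x = v s, u (swap s t x) := by
      refine Finset.sum_bij (fun x _ => π x) ?_ ?_ ?_ fun _ _ => rfl
      · intro x hx
        simp only [Finset.mem_filter, Finset.mem_univ, true_and] at hx ⊢
        rw [hv x, hx]
      · intro x _ y _ h; exact π.injective h
      · intro y hy
        simp only [Finset.mem_filter, Finset.mem_univ, true_and] at hy
        refine ⟨π.symm y, ?_, π.apply_symm_apply y⟩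
        simp only [Finset.mem_filter, Finset.mem_univ, true_and]
        rw [← hv, π.apply_symm_apply, hy]
    have hs : s ∈ Finset.univ.filter fun x => v x = v s := by simp
    rw [h1, ← Finset.add_sum_erase _ _ hs, ← Finset.add_sum_erase _ _ hs, swap_apply_left] at h2
    have h3 : ∑ x ∈ (Finset.univ.filter fun x => v x = v s).erase s, u (swap s t x) =
        ∑ x ∈ (Finset.univ.filter fun x => v x = v s).erase s, u x := by
      refine Finset.sum_congr rfl fun x hx => ?_
      rw [swap_apply_of_ne_of_ne (Finset.ne_of_mem_erase hx)]
      rintro rfl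
      exact hst (Finset.mem_filter.1 (Finset.mem_of_mem_erase hx)).2.symm
    rw [h3] at h2
    exact add_right_cancel h2
  refine ⟨fun x => ?_, mem_ker_difference.2 key⟩
  rw [← hu x, Perm.mul_apply, swap_apply_def]
  split_ifs with h3 h4
  · rw [h3, key]
  · rw [h4, key]
  · rfl

lemma fixedFunctions_swap_mul_inf_le (π : Perm α) (s t : α) :
    fixedFunctions (swap s t * π) ⊓ LinearMap.ker (difference s t) ≤ fixedFunctions π := by
  rintro u ⟨hu, hst⟩ x
  have key : u s = u t := mem_ker_difference.1 hst
  rw [← hu x, Perm.mul_apply, swap_apply_def]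
  split_ifs with h3 h4
  · rw [h3, key]
  · rw [h4, key]
  · rfl

/-- The dimensions count cycles of the two permutations and, on the right, orbits of the generated
group. A new transposition inside an orbit adds at most one cycle, paid for by the length. One
joining two orbits costs one orbit, hence two on the right, but also merges two cycles. -/
lemma finrank_fixedFunctions_add_le [Fintype α] (σ : Perm α) (L : List (α × α)) :
    Module.finrank (ZMod 2) (fixedFunctions (listProd L * σ)) +
      Module.finrank (ZMod 2) (fixedFunctions σ) ≤
      L.length + 2 * Module.finrank (ZMod 2) (fixedFunctionsList σ L) := by
  induction L with
  | nil =>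
    have : fixedFunctionsList σ [] = fixedFunctions σ := by
      ext v; simp [mem_fixedFunctionsList, mem_fixedFunctions]
    rw [listProd_nil, one_mul, this, List.length_nil]
    omega
  | cons q L ih =>
    have hK : fixedFunctionsList σ (q :: L) =
        fixedFunctionsList σ L ⊓ LinearMap.ker (difference q.1 q.2) := by
      ext v
      simp only [mem_fixedFunctionsList, Submodule.mem_inf, mem_ker_difference,
        List.forall_mem_cons]
      tauto
    rw [listProd_cons, mul_assoc, List.length_cons]
    by_cases h : fixedFunctionsList σ L ≤ LinearMap.ker (difference q.1 q.2)
    · rw [hK, inf_eq_left.2 h]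
      have h1 := finrank_le_finrank_inf_ker
        (fixedFunctions (swap q.1 q.2 * (listProd L * σ))) q.1 q.2
      have h2 := Submodule.finrank_mono
        (fixedFunctions_swap_mul_inf_le (listProd L * σ) q.1 q.2)
      omega
    · obtain ⟨v, hvL, hv⟩ := SetLike.not_le_iff_exists.1 h
      rw [mem_ker_difference] at hv
      have hvf := fixedFunctionsList_le σ L hvL
      have h1 := Submodule.finrank_mono (fixedFunctions_swap_mul_le hvf hv)
      have h2 : Module.finrank (ZMod 2) (fixedFunctions (listProd L * σ) ⊓
          LinearMap.ker (difference q.1 q.2) : Submodule _ _) <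
          Module.finrank (ZMod 2) (fixedFunctions (listProd L * σ)) :=
        Submodule.finrank_lt_finrank_of_lt (lt_of_le_of_ne inf_le_left fun heq =>
          hv (mem_ker_difference.1 (inf_eq_left.1 heq hvf)))
      have h3 := finrank_le_finrank_inf_ker (fixedFunctionsList σ L) q.1 q.2
      rw [hK]
      omega

/-- For the `2 × 2` identity matrix, `permTrace` counts the invariant maps to a two-element set,
while the cycle formula gives `2` to the number of cycles. Over `𝔽₂` that count is also `2` to the
dimension. -/
lemma finrank_fixedFunctions [Fintype α] (σ : Perm α) :
    Module.finrank (ZMod 2) (fixedFunctions σ) = σ.partition.parts.card := by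
  classical
  have h1 := permTrace_eq_prod_parts (1 : Matrix (Fin 2) (Fin 2) ℂ) σ
  simp only [one_pow, Matrix.trace_one, Fintype.card_fin, Multiset.map_const',
    Multiset.prod_replicate] at h1
  have h2 : permTrace σ (fun _ => (1 : Matrix (Fin 2) (Fin 2) ℂ)) =
      (Fintype.card (fixedFunctions σ) : ℂ) := by
    rw [permTrace]
    have : ∀ m : α → Fin 2, ∏ x, (1 : Matrix (Fin 2) (Fin 2) ℂ) (m x) (m (σ x)) =
        if ∀ x, m (σ x) = m x then 1 else 0 := by
      intro m
      simp only [Matrix.one_apply, Finset.prod_boole, Finset.mem_univ, true_implies, eq_comm]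
    simp only [this, Finset.sum_boole]
    rw [Nat.cast_inj, ← Fintype.card_subtype]
    exact Fintype.card_congr (Equiv.refl _)
  rw [h2, Module.card_eq_pow_finrank (K := ZMod 2), ZMod.card] at h1
  exact Nat.pow_right_injective le_rfl (by exact_mod_cast h1)

lemma partition_inv_parts [Fintype α] (σ : Perm α) :
    σ⁻¹.partition.parts = σ.partition.parts := by
  rw [Perm.parts_partition, Perm.parts_partition, Perm.cycleType_inv, Perm.support_inv]

lemma permTrace_inv {N : ℕ} [Fintype α] (σ : Perm α) (A : Matrix (Fin N) (Fin N) ℂ) :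
    permTrace σ⁻¹ (fun _ => A) = permTrace σ (fun _ => A) := by
  rw [permTrace_eq_prod_parts, permTrace_eq_prod_parts, partition_inv_parts]

/-- The genus of a connected factorization is nonnegative. -/
lemma card_parts_add_card_parts_le [Fintype α] [Nonempty α] {ρ σ : Perm α}
    {L : List (α × α)} (h : ρ * σ = listProd L) (hc : IsConnected σ L) :
    ρ.partition.parts.card + σ.partition.parts.card ≤ L.length + 2 := by
  have h1 := finrank_fixedFunctions_add_le σ⁻¹ L
  have h2 := finrank_fixedFunctionsList_le_one hc.inv
  rw [← h, mul_inv_cancel_right, finrank_fixedFunctions, finrank_fixedFunctions,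
    partition_inv_parts] at h1
  omega

lemma sign_eq_neg_one_pow_card_parts [Fintype α] (σ : Perm α) :
    Perm.sign σ = (-1) ^ (Fintype.card α + σ.partition.parts.card) := by
  have h1 : σ.support.card ≤ Fintype.card α := Finset.card_le_univ _
  rw [Perm.sign_of_cycleType, Perm.parts_partition, Multiset.card_add, Multiset.card_replicate,
    Perm.sum_cycleType]
  rw [show Fintype.card α + (σ.cycleType.card + (Fintype.card α - σ.support.card)) =
    σ.support.card + σ.cycleType.card + 2 * (Fintype.card α - σ.support.card) by omega,
    pow_add _ _ (2 * _), pow_mul]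
  simp

lemma sign_listProd [Fintype α] {L : List (α × α)} (hL : ∀ q ∈ L, q.1 ≠ q.2) :
    Perm.sign (listProd L) = (-1) ^ L.length := by
  induction L with
  | nil => simp
  | cons q L ih =>
    rw [List.forall_mem_cons] at hL
    rw [listProd_cons, Perm.sign_mul, ih hL.2, Perm.sign_swap hL.1, List.length_cons, pow_succ']

/-- The genus of a connected factorization is an integer. -/
lemma exists_genus [Fintype α] [Nonempty α] {ρ σ : Perm α} {L : List (α × α)}
    (hL : ∀ q ∈ L, q.1 ≠ q.2) (h : ρ * σ = listProd L) (hc : IsConnected σ L) :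
    ∃ g, L.length + 2 = 2 * g + ρ.partition.parts.card + σ.partition.parts.card := by
  have h1 := card_parts_add_card_parts_le h hc
  have h2 := congrArg Perm.sign h
  rw [sign_listProd hL, Perm.sign_mul, sign_eq_neg_one_pow_card_parts,
    sign_eq_neg_one_pow_card_parts, ← pow_add] at h2
  -- Comparing signs of `ρ * σ` and of the product of transpositions fixes the parity; nonnegativity
  -- is `h1`, so the subtraction is not truncated.
  have h3 : Even (L.length + 2 - (ρ.partition.parts.card + σ.partition.parts.card)) := by
    have h4 : Even (Fintype.card α + ρ.partition.parts.card +
        (Fintype.card α + σ.partition.parts.card)) ↔ Even L.length := by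
      have := congrArg (fun u : ℤˣ => (u : ℤ)) h2
      simp only [Units.val_pow_eq_pow_val, Units.val_neg, Units.val_one] at this
      rw [← neg_one_pow_eq_one_iff_even (R := ℤ) (by norm_num),
        ← neg_one_pow_eq_one_iff_even (R := ℤ) (by norm_num), this]
    grind
  obtain ⟨g, hg⟩ := h3
  exact ⟨g, by omega⟩

end genus

/-! ### Connected factorizations and monotone Hurwitz numbers -/

section hurwitz
variable {d : ℕ}

lemma swap_eq_swap_of_lt {α : Type*} [LinearOrder α] {p q : α × α} (hp : p.1 < p.2)
    (hq : q.1 < q.2) (h : swap p.1 p.2 = swap q.1 q.2) : p = q := by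
  have h1 : swap q.1 q.2 p.1 = p.2 := by rw [← h, swap_apply_left]
  rw [swap_apply_def] at h1
  split_ifs at h1 with h2 h3
  · exact Prod.ext h2 h1.symm
  · rw [h3, ← h1] at hp
    exact absurd hp hq.not_gt
  · exact absurd h1 hp.ne

lemma prod_reverse_map_swap {α : Type*} [DecidableEq α] (L : List (α × α)) :
    ((L.map fun q => swap q.1 q.2).reverse).prod = (listProd L)⁻¹ := by
  rw [listProd, List.prod_inv_reverse, List.map_map]
  congr 3

lemma invariant_listProd {α : Type*} [DecidableEq α] {T : α → Prop} {L : List (α × α)}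
    (h : ∀ q ∈ L, T q.1 ↔ T q.2) (x : α) : T (listProd L x) ↔ T x := by
  induction L with
  | nil => simp
  | cons q L ih =>
    rw [List.forall_mem_cons] at h
    rw [listProd_cons, Perm.mul_apply, ← ih h.2, swap_apply_def]
    split_ifs with h1 h2
    · rw [h1]; exact h.1.symm
    · rw [h2]; exact h.1
    · rfl

/-- Orbits are invariant sets, and `ρ` adds no condition because it lies in the group generated by
`σ` and the transpositions. -/
lemma isConnected_iff_isPretransitive {α : Type*} [DecidableEq α] {ρ σ : Perm α}
    {L : List (α × α)} (h : ρ * σ = listProd L) {X : Set (Perm α)}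
    (hX : ∀ τ, τ ∈ X ↔ ∃ q ∈ L, swap q.1 q.2 = τ) :
    MulAction.IsPretransitive (Subgroup.closure ({ρ, σ} ∪ X) : Subgroup (Perm α)) α ↔
      IsConnected σ L := by
  constructor
  · rintro htrans T ⟨x₀, hx₀⟩ hT x
    have hinv : ∀ g ∈ Subgroup.closure ({ρ, σ} ∪ X), ∀ z, T (g z) ↔ T z := by
      intro g hg
      induction hg using Subgroup.closure_induction with
      | mem g hg =>
        rcases hg with (rfl | hg) | hg
        · intro z
          have h1 := invariant_listProd hT.2 (σ⁻¹ z)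
          have h2 := hT.1 (σ⁻¹ z)
          rw [← Perm.mul_apply, ← h, mul_inv_cancel_right] at h1
          rw [← Perm.mul_apply, mul_inv_cancel, Perm.one_apply] at h2
          rw [h1, h2]
        · rw [Set.mem_singleton_iff.1 hg]; exact hT.1
        · obtain ⟨q, hq, rfl⟩ := (hX g).1 hg
          intro z
          have := invariant_listProd (L := [q]) (T := T) (by simpa using hT.2 q hq) z
          simpa using this
      | one => intro z; rfl
      | mul f g _ _ hf hg => intro z; rw [Perm.mul_apply, hf, hg]
      | inv f _ hf =>
        intro z
        rw [← hf, ← Perm.mul_apply, mul_inv_cancel, Perm.one_apply]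
    obtain ⟨g, hg⟩ := htrans.exists_smul_eq x₀ x
    rw [← hg]
    exact (hinv g g.2 x₀).2 hx₀
  · intro hconn
    constructor
    intro x y
    have key := hconn (fun y => ∃ g : Subgroup.closure ({ρ, σ} ∪ X), g • x = y) ⟨x, 1, one_smul _ _⟩
      ⟨?_, ?_⟩ y
    · exact key
    · have hσ : σ ∈ Subgroup.closure ({ρ, σ} ∪ X) := Subgroup.subset_closure (by simp)
      intro z
      constructor
      · rintro ⟨g, hg⟩
        refine ⟨⟨σ, hσ⟩⁻¹ * g, ?_⟩
        rw [mul_smul, hg, inv_smul_eq_iff]; rfl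
      · rintro ⟨g, hg⟩
        exact ⟨⟨σ, hσ⟩ * g, by rw [mul_smul, hg]; rfl⟩
    · intro q hq
      have hτ : swap q.1 q.2 ∈ Subgroup.closure ({ρ, σ} ∪ X) :=
        Subgroup.subset_closure (Or.inr ((hX _).2 ⟨q, hq, rfl⟩))
      constructor
      · rintro ⟨g, hg⟩
        refine ⟨⟨_, hτ⟩ * g, ?_⟩
        rw [mul_smul, hg]; exact swap_apply_left _ _
      · rintro ⟨g, hg⟩
        refine ⟨⟨_, hτ⟩ * g, ?_⟩
        rw [mul_smul, hg]; exact swap_apply_right _ _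

/-- The connected monotone factorizations of length `r` with given cycle types. -/
def connectedFactorizations (α β : Nat.Partition d) (r : ℕ) :
    Finset (List (Fin d × Fin d) × Perm (Fin d)) :=
  @Finset.filter _ (fun x => IsConnected x.2 x.1 ∧
    (listProd x.1 * x.2⁻¹).partition.parts = α.parts ∧ x.2.partition.parts = β.parts)
    (Classical.decPred _) (monoLists (Fin d) r ×ˢ Finset.univ)

lemma mem_connectedFactorizations {α β : Nat.Partition d} {r : ℕ} {L : List (Fin d × Fin d)}
    {σ : Perm (Fin d)} : (L, σ) ∈ connectedFactorizations α β r ↔ L ∈ monoLists (Fin d) r ∧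
      IsConnected σ L ∧ (listProd L * σ⁻¹).partition.parts = α.parts ∧
        σ.partition.parts = β.parts := by
  refine (@Finset.mem_filter _ _ (Classical.decPred _) _ _).trans ?_
  simp

/-- The relation `ρ σ τ₁ ⋯ τ_r = 1` reads `ρ σ = τ_r ⋯ τ₁`. Thus the list is the reversed sequence,
its second components decrease, and `ρ` is determined by the list and `σ`. -/
lemma isMonotoneFactorization_iff {α β : Nat.Partition d} {r : ℕ} {p : Fin r → Fin d × Fin d}
    (hp : IsMonoList (List.ofFn p).reverse) (σ : Perm (Fin d)) :
    IsMonotoneFactorization α β r (listProd (List.ofFn p).reverse * σ⁻¹) σ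
        (fun i => swap (p i).1 (p i).2) ↔
      ((List.ofFn p).reverse, σ) ∈ connectedFactorizations α β r := by
  have hprod : (List.ofFn fun i => swap (p i).1 (p i).2).prod =
      (listProd (List.ofFn p).reverse)⁻¹ := by
    rw [← prod_reverse_map_swap]
    congr 1
    rw [← List.map_reverse, List.reverse_reverse, List.map_ofFn]
    rfl
  have htr := isConnected_iff_isPretransitive (ρ := listProd (List.ofFn p).reverse * σ⁻¹)
    (σ := σ) (L := (List.ofFn p).reverse) (inv_mul_cancel_right _ _)
    (X := Set.range fun i => swap (p i).1 (p i).2) (by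
      intro τ
      simp [List.mem_ofFn])
  rw [mem_connectedFactorizations]
  constructor
  · intro h
    exact ⟨by simp [mem_monoLists, hp], htr.1 h.transitive, h.cycleType_left, h.cycleType_right⟩
  · rintro ⟨-, h1, h2, h3⟩
    refine ⟨h2, h3, fun i => ?_, ?_, htr.2 h1, fun i => (p i).1, fun i => (p i).2, fun i => ⟨?_, rfl⟩,
      ?_⟩
    · exact ⟨_, _, (hp.1 (p i) (by simp [List.mem_ofFn])).ne, rfl⟩
    · rw [inv_mul_cancel_right, hprod, mul_inv_cancel]
    · exact hp.1 (p i) (by simp [List.mem_ofFn])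
    · have := hp.2
      rw [List.pairwise_reverse, List.pairwise_ofFn] at this
      intro i j hij
      rcases hij.eq_or_lt with rfl | hlt
      · exact le_rfl
      · exact this hlt

lemma ncard_isMonotoneFactorization (α β : Nat.Partition d) (r : ℕ) :
    Set.ncard {x : Perm (Fin d) × Perm (Fin d) × (Fin r → Perm (Fin d)) |
      IsMonotoneFactorization α β r x.1 x.2.1 x.2.2} = (connectedFactorizations α β r).card := by
  rw [← Set.ncard_coe_finset]
  symm
  have hex : ∀ L : List (Fin d × Fin d), L.length = r →
      ∃ p : Fin r → Fin d × Fin d, L = (List.ofFn p).reverse := by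
    rintro L rfl
    refine ⟨fun i => L.reverse.get (i.cast (by simp)), ?_⟩
    rw [← List.reverse_inj, List.reverse_reverse]
    refine List.ext_getElem (by simp) fun i h1 h2 => ?_
    simp
  have hget : ∀ p : Fin r → Fin d × Fin d, (fun i : Fin r =>
      (((List.ofFn p).reverse.map fun q => swap q.1 q.2).reverse).getD i (1 : Perm (Fin d))) =
      fun i => swap (p i).1 (p i).2 := by
    intro p
    ext1 i
    rw [← List.map_reverse, List.reverse_reverse, List.map_ofFn,
      List.getD_eq_getElem _ _ (by simp)]
    simp
  -- The default value `1` of `getD` is never read, because the lists have length `r`.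
  refine Set.ncard_congr (fun x _ => (listProd x.1 * x.2⁻¹, x.2, fun i : Fin r =>
    ((x.1.map fun q => swap q.1 q.2).reverse).getD i 1)) ?_ ?_ ?_
  · rintro ⟨L, σ⟩ hx
    have hL := mem_monoLists.1 (mem_connectedFactorizations.1 hx).1
    obtain ⟨p, rfl⟩ := hex L hL.1
    simp only [hget]
    exact (isMonotoneFactorization_iff hL.2 σ).2 hx
  · rintro ⟨L, σ⟩ ⟨L', σ'⟩ hx hx' heq
    have hL := mem_monoLists.1 (mem_connectedFactorizations.1 hx).1
    have hL' := mem_monoLists.1 (mem_connectedFactorizations.1 hx').1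
    obtain ⟨p, rfl⟩ := hex L hL.1
    obtain ⟨p', rfl⟩ := hex L' hL'.1
    simp only [hget, Prod.mk.injEq] at heq
    obtain ⟨-, rfl, h⟩ := heq
    have : p = p' := by
      ext1 i
      exact swap_eq_swap_of_lt (hL.2.1 (p i) (by simp [List.mem_ofFn]))
        (hL'.2.1 (p' i) (by simp [List.mem_ofFn])) (congrFun h i)
    rw [this]
  · rintro ⟨ρ, σ, τ⟩ hx
    obtain ⟨s, t, hst, hmono⟩ := hx.monotone
    let p : Fin r → Fin d × Fin d := fun i => (s i, t i)
    have hτ : τ = fun i => swap (p i).1 (p i).2 := funext fun i => (hst i).2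
    have hp : IsMonoList (List.ofFn p).reverse := by
      constructor
      · intro q hq
        rw [List.mem_reverse, List.mem_ofFn] at hq
        obtain ⟨i, rfl⟩ := hq
        exact (hst i).1
      · rw [List.pairwise_reverse, List.pairwise_ofFn]
        exact fun i j hij => hmono hij.le
    have hρ : ρ = listProd (List.ofFn p).reverse * σ⁻¹ := by
      have h1 := hx.prod_eq_one
      simp only [hτ] at h1
      have h2 := prod_reverse_map_swap (List.ofFn p).reverse
      rw [← List.map_reverse, List.reverse_reverse, List.map_ofFn] at h2
      rw [eq_mul_inv_iff_mul_eq, ← inv_inj, ← h2]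
      exact (eq_inv_of_mul_eq_one_right h1).symm
    refine ⟨((List.ofFn p).reverse, σ), ?_, ?_⟩
    · have hx' : IsMonotoneFactorization α β r ρ σ τ := hx
      rw [hρ, hτ] at hx'
      exact (isMonotoneFactorization_iff hp σ).1 hx'
    · simp only [hget]
      rw [hρ, hτ]

end hurwitz

/-! ### Derivatives of the partition function -/

section derivatives
variable {N : ℕ}

lemma hasDerivAt_integral_mul_exp {g h : Matrix.unitaryGroup (Fin N) ℂ → ℂ}
    (hg : Continuous g) (hh : Continuous h) (z₀ : ℂ) :
    HasDerivAt (fun z => ∫ U, g U * Complex.exp (z * h U) ∂(haarUnitary N))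
      (∫ U, (g U * h U) * Complex.exp (z₀ * h U) ∂(haarUnitary N)) z₀ := by
  obtain ⟨K, hK⟩ : ∃ K, ∀ U, ‖h U‖ ≤ K := by
    obtain ⟨M, hM⟩ := (isCompact_range hh).isBounded.exists_norm_le
    exact ⟨M, fun U => hM _ ⟨U, rfl⟩⟩
  obtain ⟨K', hK'⟩ : ∃ K', ∀ U, ‖g U * h U‖ ≤ K' := by
    obtain ⟨M, hM⟩ := (isCompact_range (hg.mul hh)).isBounded.exists_norm_le
    exact ⟨M, fun U => hM _ ⟨U, rfl⟩⟩
  have hc : ∀ z : ℂ, Continuous fun U => g U * Complex.exp (z * h U) := fun z => by fun_prop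
  have hc' : Continuous fun U => (g U * h U) * Complex.exp (z₀ * h U) := by fun_prop
  refine (hasDerivAt_integral_of_dominated_loc_of_deriv_le
    (F' := fun z U => (g U * h U) * Complex.exp (z * h U))
    (bound := fun _ => K' * Real.exp ((‖z₀‖ + 1) * K))
    (Metric.ball_mem_nhds z₀ one_pos)
    (Filter.Eventually.of_forall fun z => (hc z).aestronglyMeasurable)
    (integrable_of_continuous (hc z₀)) hc'.aestronglyMeasurable
    (Filter.Eventually.of_forall fun U z hz => ?_) (integrable_const _)
    (Filter.Eventually.of_forall fun U z _ => ?_)).2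
  · have hz' : ‖z‖ ≤ ‖z₀‖ + 1 := by
      have h1 := norm_sub_norm_le z z₀
      have h2 : ‖z - z₀‖ < 1 := by simpa [dist_eq_norm] using hz
      linarith
    rw [norm_mul]
    refine mul_le_mul (hK' U) ?_ (norm_nonneg _) ((norm_nonneg _).trans (hK' U))
    refine (Complex.norm_exp_le_exp_norm _).trans (Real.exp_le_exp.2 ?_)
    rw [norm_mul]
    exact mul_le_mul hz' (hK U) (norm_nonneg _) (by positivity)
  · have h1 : HasDerivAt (fun z : ℂ => z * h U) (h U) z := hasDerivAt_mul_const _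
    exact (h1.cexp.const_mul (g U)).congr_deriv (by ring)

lemma iteratedDeriv_integral_exp {h : Matrix.unitaryGroup (Fin N) ℂ → ℂ} (hh : Continuous h)
    (k : ℕ) : iteratedDeriv k (fun z => ∫ U, Complex.exp (z * h U) ∂(haarUnitary N)) =
      fun z => ∫ U, h U ^ k * Complex.exp (z * h U) ∂(haarUnitary N) := by
  induction k with
  | zero => simp
  | succ k ih =>
    rw [iteratedDeriv_succ, ih]
    ext z
    rw [(hasDerivAt_integral_mul_exp (g := fun U => h U ^ k) (hh.pow k) hh z).deriv]
    simp only [pow_succ]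

lemma iteratedDeriv_partitionFunction_zero (A B : Matrix (Fin N) (Fin N) ℂ) (k : ℕ) :
    iteratedDeriv k (partitionFunction A B) 0 =
      (-1) ^ k * ((N : ℂ) ^ k * ∫ U, (A * conjBy U B).trace ^ k ∂(haarUnitary N)) := by
  have h1 : partitionFunction A B = fun z => ∫ U,
      Complex.exp (z * (-N * (A * conjBy U B).trace)) ∂(haarUnitary N) := by
    ext z
    simp only [partitionFunction, conjBy, Matrix.mul_assoc]
    refine integral_congr_ae (Filter.Eventually.of_forall fun U => ?_)
    simp only
    congr 1
    ring
  have hc : Continuous fun U => -(N : ℂ) * (A * conjBy U B).trace :=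
    continuous_const.mul (continuous_const.mul (continuous_conjBy B)).matrix_trace
  rw [h1, iteratedDeriv_integral_exp hc, ← mul_assoc, ← mul_pow, ← integral_const_mul]
  simp only [zero_mul, Complex.exp_zero, mul_one, mul_pow, neg_one_mul]

lemma hasSum_factorizationSum (hN : N ≠ 0) {d : ℕ} (hd : d ≤ N)
    (A B : Matrix (Fin N) (Fin N) ℂ) :
    HasSum (fun r => (-(N : ℂ)⁻¹) ^ r * factorizationSum A B (Fin d) r)
      ((-1) ^ d * iteratedDeriv d (partitionFunction A B) 0) := by
  rw [iteratedDeriv_partitionFunction_zero, ← mul_assoc, ← mul_pow]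
  simp only [mul_neg, mul_one, neg_neg, one_pow, one_mul]
  convert hasSum_integral_trace_pow hN hd A B using 3 with r
  rw [factorizationSum]
  refine Finset.sum_congr rfl fun L _ => ?_
  -- Replacing `σ` by its inverse matches the convention of `weight`; `permTrace` with a constant
  -- matrix is unchanged by inversion.
  rw [← Equiv.sum_comp (Equiv.inv (Perm (Fin d)))]
  refine Finset.sum_congr rfl fun σ _ => ?_
  rw [weight, Equiv.inv_apply, inv_inv, permTrace_inv, permTrace_inv]

/-! ### Passage to the logarithm -/

/-- The recursion relating the derivatives of a function to those of its logarithm. -/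
lemma iteratedDeriv_partitionFunction_succ {A B : Matrix (Fin N) (Fin N) ℂ} {D : Set ℂ}
    (hD : IsAdmissibleDomain A B D) {F : ℂ → ℂ} (hF : IsFreeEnergy A B D F) (n : ℕ) :
    iteratedDeriv (n + 1) (partitionFunction A B) 0 = ∑ k ∈ Finset.range (n + 1),
      (n.choose k : ℂ) * ((N : ℂ) ^ 2 * iteratedDeriv (k + 1) F 0) *
        iteratedDeriv (n - k) (partitionFunction A B) 0 := by
  have hI : ∀ z, AnalyticAt ℂ (partitionFunction A B) z := fun z =>
    (differentiable_partitionFunction A B).analyticAt z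
  have hFa : AnalyticAt ℂ F 0 :=
    hF.differentiableOn.analyticAt (hD.isOpen.mem_nhds hD.zero_mem)
  have hG : AnalyticAt ℂ (fun z => (N : ℂ) ^ 2 * deriv F z) 0 :=
    analyticAt_const.mul hFa.deriv
  -- This is `I' = N² F' I` near `0`; the Leibniz rule then yields the recursion.
  have heq : deriv (partitionFunction A B) =ᶠ[𝓝 0]
      (fun z => (N : ℂ) ^ 2 * deriv F z) * partitionFunction A B := by
    filter_upwards [hD.isOpen.mem_nhds hD.zero_mem] with z hz
    have h1 : partitionFunction A B =ᶠ[𝓝 z] fun w => Complex.exp ((N : ℂ) ^ 2 * F w) := by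
      filter_upwards [hD.isOpen.mem_nhds hz] with w hw using hF.exp_eq w hw
    have h2 : HasDerivAt F (deriv F z) z :=
      (hF.differentiableOn.differentiableAt (hD.isOpen.mem_nhds hz)).hasDerivAt
    rw [h1.deriv_eq, ((h2.const_mul ((N : ℂ) ^ 2)).cexp).deriv, Pi.mul_apply, hF.exp_eq z hz]
    ring
  rw [iteratedDeriv_succ', heq.iteratedDeriv_eq, iteratedDeriv_mul hG.contDiffAt (hI 0).contDiffAt]
  refine Finset.sum_congr rfl fun k _ => ?_
  rw [iteratedDeriv_const_mul_field, iteratedDeriv_succ']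

lemma hasSum_mul_antidiagonal {f g : ℕ → ℂ} {a b : ℂ} (hf : HasSum f a) (hg : HasSum g b) :
    HasSum (fun r => ∑ x ∈ Finset.HasAntidiagonal.antidiagonal r, f x.1 * g x.2) (a * b) := by
  have h1 := (summable_norm_sum_mul_antidiagonal_of_summable_norm hf.summable.norm
    hg.summable.norm).of_norm
  have h2 := tsum_mul_tsum_eq_tsum_sum_antidiagonal_of_summable_norm hf.summable.norm
    hg.summable.norm
  rw [hf.tsum_eq, hg.tsum_eq] at h2
  rw [h2]
  exact h1.hasSum

lemma factorizationSum_fin_zero (A B : Matrix (Fin N) (Fin N) ℂ) (r : ℕ) :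
    factorizationSum A B (Fin 0) r = if r = 0 then 1 else 0 := by
  split_ifs with hr
  · subst hr
    rw [factorizationSum, sum_monoLists_zero]
    simp [weight, permTrace]
  · rw [factorizationSum, Finset.sum_eq_zero]
    intro L hL
    obtain ⟨hl, -⟩ := mem_monoLists.1 hL
    obtain _ | ⟨p, L⟩ := L
    · exact absurd hl.symm hr
    · exact p.1.elim0

/-- The derivatives of the free energy count connected factorizations. -/
theorem hasSum_connectedSum (hN : N ≠ 0) {A B : Matrix (Fin N) (Fin N) ℂ} {D : Set ℂ}
    (hD : IsAdmissibleDomain A B D) {F : ℂ → ℂ} (hF : IsFreeEnergy A B D F) {n : ℕ}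
    (hn : n + 1 ≤ N) :
    HasSum (fun r => (-(N : ℂ)⁻¹) ^ r * connectedSum A B (Fin (n + 1)) r)
      ((-1) ^ (n + 1) * ((N : ℂ) ^ 2 * iteratedDeriv (n + 1) F 0)) := by
  induction n using Nat.strong_induction_on with
  | _ n ih =>
  have hW := hasSum_factorizationSum hN hn A B
  have hS : ∀ k ∈ Finset.range n, HasSum (fun r => (n.choose k : ℂ) *
      ∑ x ∈ Finset.HasAntidiagonal.antidiagonal r,
        ((-(N : ℂ)⁻¹) ^ x.1 * connectedSum A B (Fin (k + 1)) x.1) *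
        ((-(N : ℂ)⁻¹) ^ x.2 * factorizationSum A B (Fin (n - k)) x.2))
      ((n.choose k : ℂ) * (((-1) ^ (k + 1) * ((N : ℂ) ^ 2 * iteratedDeriv (k + 1) F 0)) *
        ((-1) ^ (n - k) * iteratedDeriv (n - k) (partitionFunction A B) 0))) := by
    intro k hk
    have hk' := Finset.mem_range.1 hk
    exact (hasSum_mul_antidiagonal (ih k hk' (by omega))
      (hasSum_factorizationSum hN (by omega) A B)).mul_left _
  -- In both recursions the term `k = n` has coefficient one and contains the unknown multiplied by
  -- a trivial factor (`I(0) = 1`, respectively the empty factorization), so it is isolated by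
  -- subtracting the terms `k < n`.
  have h := hW.sub (hasSum_sum hS)
  have hval : (-1) ^ (n + 1) * ((N : ℂ) ^ 2 * iteratedDeriv (n + 1) F 0) =
      (-1) ^ (n + 1) * iteratedDeriv (n + 1) (partitionFunction A B) 0 -
      ∑ k ∈ Finset.range n, (n.choose k : ℂ) *
        (((-1) ^ (k + 1) * ((N : ℂ) ^ 2 * iteratedDeriv (k + 1) F 0)) *
        ((-1) ^ (n - k) * iteratedDeriv (n - k) (partitionFunction A B) 0)) := by
    rw [iteratedDeriv_partitionFunction_succ hD hF, Finset.sum_range_succ, mul_add,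
      Finset.mul_sum]
    have : ∀ k ∈ Finset.range n, (n.choose k : ℂ) *
        (((-1) ^ (k + 1) * ((N : ℂ) ^ 2 * iteratedDeriv (k + 1) F 0)) *
        ((-1) ^ (n - k) * iteratedDeriv (n - k) (partitionFunction A B) 0)) =
        (-1) ^ (n + 1) * ((n.choose k : ℂ) * ((N : ℂ) ^ 2 * iteratedDeriv (k + 1) F 0) *
        iteratedDeriv (n - k) (partitionFunction A B) 0) := by
      intro k hk
      have hk' := Finset.mem_range.1 hk
      have e : (-1 : ℂ) ^ (n + 1) = (-1) ^ (k + 1) * (-1) ^ (n - k) := by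
        rw [← pow_add]; congr 1; omega
      rw [e]
      ring
    rw [Finset.sum_congr rfl this]
    simp [partitionFunction_zero]
  rw [hval]
  refine h.congr_fun fun r => ?_
  rw [factorizationSum_fin_succ, Finset.mul_sum, Finset.sum_range_succ]
  have e1 : ∀ k, (-(N : ℂ)⁻¹) ^ r * ((n.choose k : ℂ) *
      ∑ x ∈ Finset.HasAntidiagonal.antidiagonal r,
        connectedSum A B (Fin (k + 1)) x.1 * factorizationSum A B (Fin (n - k)) x.2) =
      (n.choose k : ℂ) * ∑ x ∈ Finset.HasAntidiagonal.antidiagonal r,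
        ((-(N : ℂ)⁻¹) ^ x.1 * connectedSum A B (Fin (k + 1)) x.1) *
        ((-(N : ℂ)⁻¹) ^ x.2 * factorizationSum A B (Fin (n - k)) x.2) := by
    intro k
    rw [mul_left_comm, Finset.mul_sum]
    congr 1
    refine Finset.sum_congr rfl fun x hx => ?_
    rw [← Finset.HasAntidiagonal.mem_antidiagonal.1 hx, pow_add]
    ring
  simp only [e1]
  rw [add_sub_cancel_left, Nat.choose_self, Nat.cast_one, one_mul, Nat.sub_self,
    Finset.sum_eq_single (r, 0)]
  · simp [factorizationSum_fin_zero]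
  · rintro ⟨a, b⟩ hx hne
    have hb : b ≠ 0 := by
      rintro rfl
      have := Finset.HasAntidiagonal.mem_antidiagonal.1 hx
      exact hne (by simpa using this)
    simp [factorizationSum_fin_zero, hb]
  · intro h
    exact absurd (Finset.HasAntidiagonal.mem_antidiagonal.2 (by simp)) h

end derivatives

/-! ### The genus expansion -/

section expansion
variable {N d : ℕ}

/-- The cycle type of a permutation of `Fin d`, as a partition of `d`. -/
def cyclePartition (σ : Perm (Fin d)) : Nat.Partition d where
  parts := σ.partition.parts
  parts_pos := σ.partition.parts_pos
  parts_sum := σ.partition.parts_sum.trans (Fintype.card_fin d)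

lemma cyclePartition_eq_iff {σ : Perm (Fin d)} {α : Nat.Partition d} :
    cyclePartition σ = α ↔ σ.partition.parts = α.parts := Nat.Partition.ext_iff

lemma weight_eq_powerSum (A B : Matrix (Fin N) (Fin N) ℂ) (L : List (Fin d × Fin d))
    (σ : Perm (Fin d)) : weight A B L σ =
      powerSum (cyclePartition (listProd L * σ⁻¹)) A * powerSum (cyclePartition σ) B := by
  rw [weight, permTrace_eq_prod_parts, permTrace_eq_prod_parts]
  rfl

lemma connectedSum_eq_sum_partitions (A B : Matrix (Fin N) (Fin N) ℂ) (r : ℕ) :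
    connectedSum A B (Fin d) r = ∑ α : Nat.Partition d, ∑ β : Nat.Partition d,
      ((connectedFactorizations α β r).card : ℂ) * (powerSum α A * powerSum β B) := by
  classical
  have h1 : ∀ α β : Nat.Partition d,
      ((connectedFactorizations α β r).card : ℂ) * (powerSum α A * powerSum β B) =
      ∑ L ∈ monoLists (Fin d) r, ∑ σ : Perm (Fin d), if IsConnected σ L then
        (if cyclePartition (listProd L * σ⁻¹) = α then (if cyclePartition σ = β then
          powerSum α A * powerSum β B else 0) else 0) else 0 := by
    intro α β
    rw [← nsmul_eq_mul, ← Finset.sum_const, ← Finset.sum_product' (s := monoLists (Fin d) r)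
      (t := Finset.univ) (f := fun L σ => if IsConnected σ L then
        (if cyclePartition (listProd L * σ⁻¹) = α then (if cyclePartition σ = β then
          powerSum α A * powerSum β B else 0) else 0) else 0)]
    simp only [← ite_and]
    rw [← Finset.sum_filter]
    refine Finset.sum_congr ?_ fun _ _ => rfl
    ext ⟨L, σ⟩
    rw [mem_connectedFactorizations, Finset.mem_filter, Finset.mem_product]
    simp only [Finset.mem_univ, and_true, cyclePartition_eq_iff]
  simp only [h1]
  have h2 : ∀ f : Nat.Partition d → List (Fin d × Fin d) → Perm (Fin d) → ℂ,
      ∑ α : Nat.Partition d, ∑ L ∈ monoLists (Fin d) r, ∑ σ : Perm (Fin d), f α L σ =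
      ∑ L ∈ monoLists (Fin d) r, ∑ σ : Perm (Fin d), ∑ α : Nat.Partition d, f α L σ := by
    intro f
    rw [Finset.sum_comm]
    exact Finset.sum_congr rfl fun L _ => Finset.sum_comm
  simp only [h2]
  rw [connectedSum]
  refine Finset.sum_congr rfl fun L _ => Finset.sum_congr rfl fun σ _ => ?_
  split_ifs
  · simp [weight_eq_powerSum]
  · simp

/-- By `exists_genus`, every connected factorization has an integral genus, so other lengths do not
occur. -/
lemma connectedFactorizations_eq_empty (hd : 1 ≤ d) {α β : Nat.Partition d} {r : ℕ}
    (h : r ∉ Set.range fun g => 2 * g + length α + length β - 2) :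
    connectedFactorizations α β r = ∅ := by
  have : Nonempty (Fin d) := ⟨⟨0, hd⟩⟩
  refine Finset.eq_empty_of_forall_notMem ?_
  rintro ⟨L, σ⟩ hx
  obtain ⟨hL, hc, h1, h2⟩ := mem_connectedFactorizations.1 hx
  obtain ⟨hl, hm⟩ := mem_monoLists.1 hL
  obtain ⟨g, hg⟩ := exists_genus (fun q hq => (hm.1 q hq).ne)
    (inv_mul_cancel_right (listProd L) σ) hc
  rw [h1, h2, hl] at hg
  exact h ⟨g, by simp only [length]; omega⟩

lemma length_pos (hd : 1 ≤ d) (α : Nat.Partition d) : 1 ≤ length α := by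
  rw [length, Nat.one_le_iff_ne_zero, Ne, Multiset.card_eq_zero]
  intro h
  have := α.parts_sum
  rw [h, Multiset.sum_zero] at this
  omega

lemma powerSum_one (α : Nat.Partition d) :
    powerSum α (1 : Matrix (Fin N) (Fin N) ℂ) = (N : ℂ) ^ length α := by
  simp [powerSum, length]

/-- At `A = B = 1` the convergent series `hasSum_connectedSum` has coefficients that are sums of
natural numbers. Each count occurs there multiplied by a positive power of `N`, or by `1`, so it is
dominated by the whole coefficient. -/
lemma summable_card_connectedFactorizations (hd : 1 ≤ d) (hdN : d ≤ N) (α β : Nat.Partition d) :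
    Summable fun r => (-(N : ℂ)⁻¹) ^ r * ((connectedFactorizations α β r).card : ℂ) := by
  have hN : N ≠ 0 := by omega
  obtain ⟨n, rfl⟩ : ∃ n, d = n + 1 := ⟨d - 1, by omega⟩
  obtain ⟨D, hD⟩ := exists_isAdmissibleDomain (1 : Matrix (Fin N) (Fin N) ℂ) 1
  obtain ⟨F, hF⟩ := exists_isFreeEnergy hN 1 1 hD
  have h := (hasSum_connectedSum hN hD hF hdN).summable.norm
  refine Summable.of_norm_bounded h fun r => ?_
  rw [norm_mul, norm_mul]
  refine mul_le_mul_of_nonneg_left ?_ (norm_nonneg _)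
  rw [connectedSum_eq_sum_partitions]
  simp only [powerSum_one]
  have e : (∑ α : Nat.Partition (n + 1), ∑ β : Nat.Partition (n + 1),
      ((connectedFactorizations α β r).card : ℂ) * ((N : ℂ) ^ length α * (N : ℂ) ^ length β)) =
      ((∑ α : Nat.Partition (n + 1), ∑ β : Nat.Partition (n + 1),
        (connectedFactorizations α β r).card * (N ^ length α * N ^ length β) : ℕ) : ℂ) := by
    push_cast; rfl
  rw [e, Complex.norm_natCast, Complex.norm_natCast]
  have h1 : (connectedFactorizations α β r).card ≤
      (connectedFactorizations α β r).card * (N ^ length α * N ^ length β) :=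
    Nat.le_mul_of_pos_right _ (by positivity)
  have h2 := Finset.single_le_sum (s := Finset.univ) (f := fun β : Nat.Partition (n + 1) =>
    (connectedFactorizations α β r).card * (N ^ length α * N ^ length β))
    (fun _ _ => Nat.zero_le _) (Finset.mem_univ β)
  have h3 := Finset.single_le_sum (s := Finset.univ) (f := fun α : Nat.Partition (n + 1) =>
    ∑ β : Nat.Partition (n + 1),
    (connectedFactorizations α β r).card * (N ^ length α * N ^ length β))
    (fun _ _ => Nat.zero_le _) (Finset.mem_univ α)
  exact_mod_cast h1.trans (h2.trans h3)

lemma monotoneHurwitz_eq_card (g : ℕ) (α β : Nat.Partition d) : monotoneHurwitz g α β =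
    (connectedFactorizations α β (2 * g + length α + length β - 2)).card :=
  ncard_isMonotoneFactorization α β _

end expansion

end HCIZ

end

/-! ### Regrouping by cycle type and genus -/

theorem theorem1 {N : ℕ} (A B : Matrix (Fin N) (Fin N) ℂ)
    (hA : IsStarNormal A) (hB : IsStarNormal B)
    (D : Set ℂ) (hD : HCIZ.IsAdmissibleDomain A B D)
    (F : ℂ → ℂ) (hF : HCIZ.IsFreeEnergy A B D F)
    (d : ℕ) (hd : 1 ≤ d) (hdN : d ≤ N) :
    Summable (fun g : ℕ => ‖HCIZ.coeff g d A B / (N : ℂ) ^ (2 * g)‖) ∧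
      HasSum (fun g : ℕ => HCIZ.coeff g d A B / (N : ℂ) ^ (2 * g)) (iteratedDeriv d F 0) := by
  open HCIZ in
  suffices h : HasSum (fun g : ℕ => coeff g d A B / (N : ℂ) ^ (2 * g)) (iteratedDeriv d F 0) from
    ⟨h.summable.norm, h⟩
  have hN : N ≠ 0 := by omega
  have hN' : (N : ℂ) ≠ 0 := Nat.cast_ne_zero.2 hN
  have hsum := summable_card_connectedFactorizations hd hdN
  have h1 : HasSum (fun r => (-(N : ℂ)⁻¹) ^ r * connectedSum A B (Fin d) r)
      ((-1) ^ d * ((N : ℂ) ^ 2 * iteratedDeriv d F 0)) := by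
    obtain ⟨n, rfl⟩ : ∃ n, d = n + 1 := ⟨d - 1, by omega⟩
    exact hasSum_connectedSum hN hD hF hdN
  -- Separate summability for each `α`, `β` allows the series over `r` to be exchanged with the
  -- finite sum over partitions.
  have h2 : HasSum (fun r => (-(N : ℂ)⁻¹) ^ r * connectedSum A B (Fin d) r)
      (∑ α : Nat.Partition d, ∑ β : Nat.Partition d,
        (∑' r, (-(N : ℂ)⁻¹) ^ r * ((connectedFactorizations α β r).card : ℂ)) *
          (powerSum α A * powerSum β B)) := by
    simp only [connectedSum_eq_sum_partitions, Finset.mul_sum, ← mul_assoc]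
    simp only [mul_assoc _ (powerSum _ A)]
    exact hasSum_sum fun α _ => hasSum_sum fun β _ => (hsum α β).hasSum.mul_right _
  -- The series over `r` is reindexed along the injection `g ↦ r`, off whose range its terms vanish.
  -- The injection depends on `α` and `β`, so this is done for each pair.
  have h3 : ∀ α β : Nat.Partition d, HasSum
      (fun g => (-(N : ℂ)⁻¹) ^ (2 * g + length α + length β - 2) * (monotoneHurwitz g α β : ℂ))
      (∑' r, (-(N : ℂ)⁻¹) ^ r * ((connectedFactorizations α β r).card : ℂ)) := by
    intro α β
    have hα := length_pos hd α
    have hβ := length_pos hd β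
    have hinj : Function.Injective fun g => 2 * g + length α + length β - 2 := by
      intro g g' h
      simp only at h
      omega
    have := (hinj.hasSum_iff (f := fun r => (-(N : ℂ)⁻¹) ^ r *
      ((connectedFactorizations α β r).card : ℂ)) fun r hr => by
        rw [connectedFactorizations_eq_empty hd hr]; simp).2 (hsum α β).hasSum
    simp only [monotoneHurwitz_eq_card]
    exact this
  have h4 : HasSum (fun g => ∑ α : Nat.Partition d, ∑ β : Nat.Partition d,
      ((-(N : ℂ)⁻¹) ^ (2 * g + length α + length β - 2) * (monotoneHurwitz g α β : ℂ)) *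
        (powerSum α A * powerSum β B)) ((-1) ^ d * ((N : ℂ) ^ 2 * iteratedDeriv d F 0)) := by
    rw [h1.unique h2]
    exact hasSum_sum fun α _ => hasSum_sum fun β _ => (h3 α β).mul_right _
  have h5 := h4.mul_left ((-1) ^ d * ((N : ℂ) ^ 2)⁻¹)
  have hval : (-1) ^ d * ((N : ℂ) ^ 2)⁻¹ * ((-1) ^ d * ((N : ℂ) ^ 2 * iteratedDeriv d F 0)) =
      iteratedDeriv d F 0 := by
    have : ((-1 : ℂ) ^ d) * (-1) ^ d = 1 := by rw [← mul_pow]; simp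
    field_simp
    linear_combination (iteratedDeriv d F 0) * this
  rw [hval] at h5
  refine h5.congr_fun fun g => ?_
  rw [coeff, Finset.sum_div, Finset.mul_sum]
  refine Finset.sum_congr rfl fun α _ => ?_
  rw [Finset.sum_div, Finset.mul_sum]
  refine Finset.sum_congr rfl fun β _ => ?_
  have hα := length_pos hd α
  have hβ := length_pos hd β
  -- Both lengths are at least one, so nothing is lost in the subtraction of `2`. As `2g` and `2`
  -- are even, `(-1) ^ r` is the sign of the two lengths, while `N ^ (-2 - r)` splits into the
  -- normalizations by `ℓ(α)`, `ℓ(β)` and `2g`.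
  obtain ⟨r, hr⟩ : ∃ r, 2 * g + length α + length β = r + 2 :=
    ⟨_, (Nat.sub_add_cancel (by omega)).symm⟩
  have e1 : (-1 : ℂ) ^ (d + length α + length β) = (-1) ^ d * (-1) ^ r := by
    have : (-1 : ℂ) ^ (length α + length β) = (-1) ^ r := by
      have h := congrArg (fun m => (-1 : ℂ) ^ m) hr
      simp only [add_assoc (2 * g), pow_add _ (2 * g), pow_mul, pow_add _ r] at h
      simpa using h
    rw [add_assoc, pow_add, this]
  have e2 : (N : ℂ) ^ (2 * g) * N ^ length α * N ^ length β = N ^ 2 * N ^ r := by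
    rw [← pow_add, ← pow_add, hr, pow_add, mul_comm]
  have e3 : ((N : ℂ) ^ length α)⁻¹ * ((N : ℂ) ^ length β)⁻¹ * ((N : ℂ) ^ (2 * g))⁻¹ =
      ((N : ℂ) ^ 2)⁻¹ * ((N : ℂ) ^ r)⁻¹ := by
    rw [← mul_inv, ← mul_inv, ← mul_inv, ← e2]
    congr 1
    ring
  rw [e1, hr, Nat.add_sub_cancel, neg_pow (N : ℂ)⁻¹, inv_pow, div_eq_mul_inv]
  linear_combination ((-1) ^ d * (-1) ^ r * (monotoneHurwitz g α β : ℂ) * powerSum α A *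
    powerSum β B) * e3
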